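/- Let $p\le n$ and let $\mathsf X=\mathbb R^n$, $\mathsf Y=\mathbb R^p$ carry Euclidean norms $|\cdot|$, Borel $\sigma$-algebras and Lebesgue measure. Consider the filtering model $$X_k=f(X_{k-1})+\zeta_k,\qquad Y_k=h(X_k)+\varepsilon_k,$$ with $f,h$ measurable, $\{\varepsilon_k\}$ i.i.d. with an everywhere positive density $v$, and $\zeta_k$ having, given $X_{k-1}=x$, the density $q(x,\cdot)$ ($q$ jointly measurable). Put $Q(x,A)=\int_A q(x,x'-f(x))\,dx'$, $g(x,y)=v(y-h(x))$, and, for a probability measure $\nu$ on $\mathsf X$, let $$\phi_{\nu,k}[y_{0:k}](A)=\frac{\int \nu(dx_0)g(x_0,y_0)\prod_{i=1}^kQ(x_{i-1},dx_i)g(x_i,y_i)\,\mathbb 1_A(x_k)}{\int \nu(dx_0)g(x_0,y_0)\prod_{i=1}^kQ(x_{i-1},dx_i)g(x_i,y_i)}$$ be the filter. Assume: (E1) $f$ is $a$-Lipschitz, $h$ is uniformly continuous and surjective, and there are constants $b_0,b$ with $|x_1-x_2|\le b_0+b|h(x_1)-h(x_2)|$ for all $x_1,x_2\in\mathsf X$.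 (E2) $v$ is bounded, $v(u)\to0$ as $|u|\to\infty$, and $\inf_Kv>0$ for every compact $K\subset\mathsf Y$. (G) There are an everywhere positive probability density $\psi$ on $\mathsf X$ and constants $\mu^-,\mu^+>0$ with $\mu^-\psi(u)\le q(x,u)\le\mu^+\psi(u)$ for all $x,u\in\mathsf X$. Let the observations $Y^*_k$ come from a possibly different model $$X^*_k=f^*(X^*_{k-1})+\zeta^*_k,\qquad Y^*_k=h^*(X^*_k)+\varepsilon^*_k,$$ defined on a probability space $(\Omega,\mathcal F,\mathbb P_\star)$, with arbitrary initial state $X_0^*$. Here $f^*$ is $a^*$-Lipschitz; $h^*$ is measurable, surjective, and satisfies $|x_1-x_2|\le b_0^*+b^*|h^*(x_1)-h^*(x_2)|$ for all $x_1,x_2$, with constants $b_0^*,b^*>0$; the variables $\{\varepsilon^*_k\}_{k\ge0}$ are i.i.d.; and, for each $k\ge1$, $\zeta^*_k$ is independent of $\varepsilon^*_k$ and has, given $X^*_0,\dots,X^*_{k-1},\varepsilon^*_0,\dots,\varepsilon^*_k$, the conditional density $q^*(X^*_{k-1},\cdot)$. The function $q^*$ is jointly measurable, each $q^*(x,\cdot)$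 is a probability density, and $\mu^*_-\psi^*(u)\le q^*(x,u)\le\mu^*_+\psi^*(u)$ for all $x,u$, for some probability density $\psi^*$ and constants $\mu^*_-,\mu^*_+>0$. Suppose that $\|f-f^*\|_\infty<\infty$ and $\|h-h^*\|_\infty<\infty$. Put $q^-(r)=\mu^-\inf_{|u|\le r}\psi(u)$, $c=(a+1)b_0$, $d=(a+1)b$, $\kappa=\|f-f^*\|_\infty+(b_0+b\|h^*-h\|_\infty)(1+a^*)$ and, for $\Delta>0$, $$V_+^{*\Delta}=\log q^-\bigl[c+d\Delta+\kappa+2a^*b^*+a^*b^*|\varepsilon_0^*|+b^*|\varepsilon_1^*|+|\zeta_+^*|\bigr]\in[-\infty,\infty),$$ where $\zeta_+^*$ has density $\psi^*$ and is independent of $\{\varepsilon^*_k\}_{k\ge0}$. Assume that $\mathbb E\bigl(|V_+^{*\Delta}|\log_+|V_+^{*\Delta}|\bigr)<\infty$ for all $\Delta>0$. Let $\mathsf C(y,\Delta)=\{x\in\mathsf X:|h(x)-y|\le\Delta\}$. Then, for all probability measures $\nu,\nu'$ on $\mathsf X$ and all $\Delta>0$ such that $\nu Q\mathbb 1_{\mathsf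 C(Y_1^*,\Delta)}>0$ and $\nu'Q\mathbb 1_{\mathsf C(Y_1^*,\Delta)}>0$, $\mathbb P_\star$-almost surely, $$\limsup_{k\to\infty}\frac1k\log\bigl\|\phi_{\nu,k}[Y^*_{0:k}]-\phi_{\nu',k}[Y^*_{0:k}]\bigr\|_{\mathrm{TV}}<0\qquad\mathbb P_\star\text{-almost surely}$$ (with $\log0=-\infty$). -/

import Mathlib

open MeasureTheory ProbabilityTheory Filter Topology
open scoped ENNReal NNReal

namespace NonlinearFilter

/-- `ℝ^d` with its Euclidean norm, Borel σ-algebra and Lebesgue measure `volume`. -/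
abbrev E (d : ℕ) : Type := EuclideanSpace ℝ (Fin d)

/-- A probability density on `ℝ^d` with respect to Lebesgue measure. -/
structure IsProbDensity {d : ℕ} (φ : E d → ℝ) : Prop where
  measurable : Measurable φ
  nonneg : ∀ u, 0 ≤ φ u
  lintegral_eq_one : ∫⁻ u, ENNReal.ofReal (φ u) = 1

/-- A measurable family `q x ·` of probability densities on `ℝ^d`, indexed by the state `x`. -/
structure IsDensityKernel {d : ℕ} (q : E d → E d → ℝ) : Prop where
  measurable : Measurable (Function.uncurry q)
  isProbDensity : ∀ x, IsProbDensity (q x)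

/-- The data of the filtering model
`X_k = f (X_{k-1}) + ζ_k`, `Y_k = h (X_k) + ε_k`: the observation noise `ε_k` has the everywhere
positive density `v`, and the law of `ζ_k` given `X_{k-1} = x` has density `q x ·`. -/
structure Model (n p : ℕ) where
  f : E n → E n
  h : E n → E p
  v : E p → ℝ
  q : E n → E n → ℝ
  measurable_f : Measurable f
  measurable_h : Measurable h
  isProbDensity_v : IsProbDensity v
  v_pos : ∀ u, 0 < v u
  isDensityKernel_q : IsDensityKernel q

namespace Model

variable {n p : ℕ}

/-- The transition kernel `Q(x, A) = ∫_A q(x, x' - f x) dx'` of the state. -/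
noncomputable def Q (M : Model n p) : Kernel (E n) (E n) :=
  Kernel.withDensity (Kernel.const (E n) (volume : Measure (E n)))
    (fun x x' => ENNReal.ofReal (M.q x (x' - M.f x)))

theorem Q_apply (M : Model n p) (x : E n) (A : Set (E n)) :
    M.Q x A = ∫⁻ x' in A, ENNReal.ofReal (M.q x (x' - M.f x)) := by
  have hm : Measurable (Function.uncurry
      (fun x x' : E n => ENNReal.ofReal (M.q x (x' - M.f x)))) := by
    refine ENNReal.measurable_ofReal.comp ?_
    exact M.isDensityKernel_q.measurable.comp
      (measurable_fst.prodMk (measurable_snd.sub (M.measurable_f.comp measurable_fst)))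
  rw [Q, Kernel.withDensity_apply' _ hm, Kernel.const_apply]

/-- The likelihood `g(x, y) = v (y - h x)`. -/
noncomputable def g (M : Model n p) (x : E n) (y : E p) : ℝ≥0∞ :=
  ENNReal.ofReal (M.v (y - M.h x))

/-- The unnormalized filter: the measure
`A ↦ ∫ ν(dx_0) g(x_0, y_0) ∏_{i=1}^k Q(x_{i-1}, dx_i) g(x_i, y_i) 1_A(x_k)`, built one
observation at a time. -/
noncomputable def unnormalizedFilter (M : Model n p) (ν : Measure (E n)) (y : ℕ → E p) :
    ℕ → Measure (E n)
  | 0 => ν.withDensity (fun x => M.g x (y 0))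
  | k + 1 => ((unnormalizedFilter M ν y k).bind M.Q).withDensity (fun x => M.g x (y (k + 1)))

/-- The filter `φ_{ν,k}[y_{0:k}]`, the law of `X_k` given the observations `y_0, …, y_k` when
`X_0` has law `ν`. -/
noncomputable def filter (M : Model n p) (ν : Measure (E n)) (y : ℕ → E p) (k : ℕ) :
    Measure (E n) :=
  (M.unnormalizedFilter ν y k Set.univ)⁻¹ • M.unnormalizedFilter ν y k

/-- The set-valued function `C(y, Δ) = {x : |h x - y| ≤ Δ}`. -/
def C (M : Model n p) (y : E p) (Δ : ℝ) : Set (E n) := {x | ‖M.h x - y‖ ≤ Δ}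

/-- Condition (E1), with its constants. -/
structure E1 (M : Model n p) (a : ℝ≥0) (b₀ b : ℝ) : Prop where
  lipschitz : LipschitzWith a M.f
  uniformContinuous : UniformContinuous M.h
  surjective : Function.Surjective M.h
  preimage_dist : ∀ y₁ y₂ : E p, ∀ x₁ x₂ : E n, M.h x₁ = y₁ → M.h x₂ = y₂ →
    ‖x₁ - x₂‖ ≤ b₀ + b * ‖y₁ - y₂‖

/-- Condition (E2). -/
structure E2 (M : Model n p) : Prop where
  bounded : ∃ B : ℝ, ∀ u, M.v u ≤ B
  tendsto_zero : Tendsto M.v (cocompact (E p)) (𝓝 0)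
  pos_on_compact : ∀ K : Set (E p), IsCompact K → ∃ m : ℝ, 0 < m ∧ ∀ u ∈ K, m ≤ M.v u

/-- Condition (G), with its density and constants. -/
structure G (M : Model n p) (ψ : E n → ℝ) (μm μp : ℝ) : Prop where
  isProbDensity : IsProbDensity ψ
  pos : ∀ u, 0 < ψ u
  lower_pos : 0 < μm
  upper_pos : 0 < μp
  lower : ∀ x u, μm * ψ u ≤ M.q x u
  upper : ∀ x u, M.q x u ≤ μp * ψ u

end Model

/-- The total variation distance `sup_A |μ(A) - μ'(A)|`. -/
noncomputable def tv {S : Type*} [MeasurableSpace S] (μ μ' : Measure S) : ℝ≥0∞ :=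
  ⨆ (A : Set S) (_ : MeasurableSet A), ENNReal.ofReal |μ.real A - μ'.real A|

/-- The observed system: a process satisfying `X_k = f⋆(X_{k-1}) + ζ_k`, `Y_k = h⋆(X_k) + ε_k`.
The noise `ε` is i.i.d., and `ζ_k` is independent of `ε_k` and has conditional density
`q⋆(X_{k-1}, ·)` given the states up to time `k-1` and the observation noises up to time `k`.
The initial state is arbitrary, and so is the value `ζ 0`, which plays no role. -/
structure IsObservedSystem {n p : ℕ} {Ω : Type*} [MeasurableSpace Ω] (P : Measure Ω)
    (fs : E n → E n) (hs : E n → E p) (qs : E n → E n → ℝ)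
    (X ζ : ℕ → Ω → E n) (ε Y : ℕ → Ω → E p) : Prop where
  measurable_X : ∀ k, Measurable (X k)
  measurable_ζ : ∀ k, Measurable (ζ k)
  measurable_ε : ∀ k, Measurable (ε k)
  state_eq : ∀ k ω, X (k + 1) ω = fs (X k ω) + ζ (k + 1) ω
  obs_eq : ∀ k ω, Y k ω = hs (X k ω) + ε k ω
  indep_ε : iIndepFun ε P
  identDistrib_ε : ∀ k, IdentDistrib (ε k) (ε 0) P P
  indep_ζ_ε : ∀ k, IndepFun (ζ (k + 1)) (ε (k + 1)) P
  cond_law : ∀ k, ∀ A : Set (E n), MeasurableSet A →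
    P⟦ζ (k + 1) ⁻¹' A | (⨆ j ∈ Set.Iic k, MeasurableSpace.comap (X j) inferInstance) ⊔
        (⨆ j ∈ Set.Iic (k + 1), MeasurableSpace.comap (ε j) inferInstance)⟧
      =ᵐ[P] fun ω => ∫ u in A, qs (X k ω) u

/-- The assumptions on the coefficients of the observed system, with their constants. -/
structure ObservedCoefficients {n p : ℕ} (fs : E n → E n) (hs : E n → E p)
    (qs : E n → E n → ℝ) (as : ℝ≥0) (b₀s bs : ℝ) (ψs : E n → ℝ) (μms μps : ℝ) : Prop where
  lipschitz : LipschitzWith as fs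
  measurable_h : Measurable hs
  surjective : Function.Surjective hs
  b₀_pos : 0 < b₀s
  b_pos : 0 < bs
  dist_le : ∀ x₁ x₂, ‖x₁ - x₂‖ ≤ b₀s + bs * ‖hs x₁ - hs x₂‖
  isDensityKernel : IsDensityKernel qs
  isProbDensity : IsProbDensity ψs
  lower_pos : 0 < μms
  upper_pos : 0 < μps
  lower : ∀ x u, μms * ψs u ≤ qs x u
  upper : ∀ x u, qs x u ≤ μps * ψs u

/-- The distance `sup_x |φ x - φ' x|`; only used together with `SupDistFinite`. -/
noncomputable def supDist {d m : ℕ} (φ φ' : E d → E m) : ℝ := ⨆ x, ‖φ x - φ' x‖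

/-- `‖φ - φ'‖_∞ < ∞`. -/
def SupDistFinite {d m : ℕ} (φ φ' : E d → E m) : Prop :=
  BddAbove (Set.range fun x => ‖φ x - φ' x‖)

/-- `q⁻(r) = μ⁻ inf_{|u| ≤ r} ψ(u)`. -/
noncomputable def qMinus {d : ℕ} (μm : ℝ) (ψ : E d → ℝ) (r : ℝ) : ℝ≥0∞ :=
  ENNReal.ofReal μm * ⨅ (u : E d) (_ : ‖u‖ ≤ r), ENNReal.ofReal (ψ u)

/-- `κ = ‖f - f⋆‖_∞ + (b₀ + b ‖h⋆ - h‖_∞) (1 + a⋆)`. -/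
noncomputable def kappa {n p : ℕ} (M : Model n p) (b₀ b : ℝ) (fs : E n → E n) (hs : E n → E p)
    (as : ℝ≥0) : ℝ :=
  supDist M.f fs + (b₀ + b * supDist hs M.h) * (1 + as)

/-- `log q⁻[c + d Δ + κ + 2 a⋆ b⋆ + a⋆ b⋆ |e₀| + b⋆ |e₁| + |w|]` with `c = (a+1) b₀` and
`d = (a+1) b`, with the value `-∞` where `q⁻` vanishes. -/
noncomputable def V (a : ℝ≥0) (b₀ b : ℝ) (as : ℝ≥0) (bs κ μm : ℝ) {n p : ℕ} (ψ : E n → ℝ)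
    (Δ : ℝ) (e₀ e₁ : E p) (w : E n) : EReal :=
  ENNReal.log (qMinus μm ψ ((a + 1) * b₀ + (a + 1) * b * Δ + κ + 2 * as * bs
    + as * bs * ‖e₀‖ + bs * ‖e₁‖ + ‖w‖))

/-- `t log_+ t` on `[0, ∞]`. -/
noncomputable def mulLogPlus (t : ℝ≥0∞) : ℝ≥0∞ := t * (ENNReal.log t).toENNReal

end NonlinearFilter

namespace NonlinearFilter

section Step

variable {Z : Type*} [MeasurableSpace Z]

/-- The measure `z' ↦ ∫ w(z, z') m(dz) Λ(dz')`. -/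
noncomputable def step (Λ : Measure Z) (w : Z → Z → ℝ≥0∞) (m : Measure Z) : Measure Z :=
  Λ.withDensity fun z' => ∫⁻ z, w z z' ∂m

instance (Λ : Measure Z) [SFinite Λ] (w : Z → Z → ℝ≥0∞) (m : Measure Z) :
    SFinite (step Λ w m) := by
  unfold step; infer_instance

theorem measurable_lintegral_left {w : Z → Z → ℝ≥0∞} (hw : Measurable (Function.uncurry w))
    (m : Measure Z) [SFinite m] : Measurable fun z' => ∫⁻ z, w z z' ∂m :=
  (hw.comp measurable_swap).lintegral_prod_right'

theorem lintegral_step (Λ : Measure Z) [SFinite Λ] {w : Z → Z → ℝ≥0∞}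
    (hw : Measurable (Function.uncurry w)) (m : Measure Z) [SFinite m] {F : Z → ℝ≥0∞}
    (hF : Measurable F) :
    ∫⁻ z', F z' ∂step Λ w m = ∫⁻ z, ∫⁻ z', w z z' * F z' ∂Λ ∂m := by
  rw [step, lintegral_withDensity_eq_lintegral_mul _ (measurable_lintegral_left hw m) hF]
  simp only [Pi.mul_apply]
  rw [lintegral_lintegral_swap]
  · refine lintegral_congr fun z' => ?_
    rw [lintegral_mul_const _ (hw.of_uncurry_right)]
  · exact (hw.mul (hF.comp measurable_snd)).aemeasurable

theorem step_mono (Λ : Measure Z) {w w' : Z → Z → ℝ≥0∞} (hw : ∀ z z', w z z' ≤ w' z z')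
    {m m' : Measure Z} (hm : m ≤ m') : step Λ w m ≤ step Λ w' m' :=
  withDensity_mono (ae_of_all _ fun z' => lintegral_mono' hm fun z => hw z z')

theorem step_add_left (Λ : Measure Z) {w w' : Z → Z → ℝ≥0∞}
    (hw : Measurable (Function.uncurry w)) (m : Measure Z) [SFinite m] :
    step Λ (fun z z' => w z z' + w' z z') m = step Λ w m + step Λ w' m := by
  rw [step, step, step, ← withDensity_add_left (measurable_lintegral_left hw m)]
  congr 1
  ext z'
  exact lintegral_add_left hw.of_uncurry_right _

theorem step_add_right (Λ : Measure Z) {w : Z → Z → ℝ≥0∞}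
    (hw : Measurable (Function.uncurry w)) (m m' : Measure Z) [SFinite m] :
    step Λ w (m + m') = step Λ w m + step Λ w m' := by
  rw [step, step, step, ← withDensity_add_left (measurable_lintegral_left hw m)]
  congr 1
  ext z'
  exact lintegral_add_measure _ _ _

theorem step_smul_right (Λ : Measure Z) {w : Z → Z → ℝ≥0∞}
    (hw : Measurable (Function.uncurry w)) (m : Measure Z) [SFinite m] (r : ℝ≥0∞) :
    step Λ w (r • m) = r • step Λ w m := by
  rw [step, step, ← withDensity_smul _ (measurable_lintegral_left hw m)]
  congr 1
  ext z'
  simp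

theorem step_smul_left (Λ : Measure Z) {w : Z → Z → ℝ≥0∞}
    (hw : Measurable (Function.uncurry w)) (m : Measure Z) [SFinite m] (r : ℝ≥0∞) :
    step Λ (fun z z' => r * w z z') m = r • step Λ w m := by
  rw [step, step, ← withDensity_smul _ (measurable_lintegral_left hw m)]
  congr 1
  ext z'
  simp [lintegral_const_mul _ (hw.of_uncurry_right (y := z'))]

end Step

section Pair

variable {S : Type*} [MeasurableSpace S]

/-- The transition density of two independent copies of the weighted chain. -/
noncomputable def pairDensity (κ : S → S → ℝ≥0∞) (g : S → ℝ≥0∞) (z z' : S × S) : ℝ≥0∞ :=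
  (κ z.1 z'.1 * g z'.1) * (κ z.2 z'.2 * g z'.2)

theorem measurable_pairDensity {κ : S → S → ℝ≥0∞} {g : S → ℝ≥0∞}
    (hκ : Measurable (Function.uncurry κ)) (hg : Measurable g) :
    Measurable (Function.uncurry (pairDensity κ g)) := by
  have h1 : Measurable fun p : (S × S) × (S × S) => κ p.1.1 p.2.1 :=
    hκ.comp (f := fun p : (S × S) × (S × S) => (p.1.1, p.2.1)) (by fun_prop)
  have h2 : Measurable fun p : (S × S) × (S × S) => κ p.1.2 p.2.2 :=
    hκ.comp (f := fun p : (S × S) × (S × S) => (p.1.2, p.2.2)) (by fun_prop)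
  have h3 : Measurable fun p : (S × S) × (S × S) => g p.2.1 := hg.comp (by fun_prop)
  have h4 : Measurable fun p : (S × S) × (S × S) => g p.2.2 := hg.comp (by fun_prop)
  exact (h1.mul h3).mul (h2.mul h4)

theorem prod_step (l : Measure S) [SFinite l] {κ : S → S → ℝ≥0∞} {g : S → ℝ≥0∞}
    (hκ : Measurable (Function.uncurry κ)) (hg : Measurable g) (m m' : Measure S)
    [SFinite m] [SFinite m'] :
    (step l (fun x x' => κ x x' * g x') m).prod (step l (fun x x' => κ x x' * g x') m') =
      step (l.prod l) (pairDensity κ g) (m.prod m') := by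
  have hw : Measurable (Function.uncurry fun x x' => κ x x' * g x') :=
    hκ.mul (hg.comp measurable_snd)
  rw [step, step, prod_withDensity (measurable_lintegral_left hw m)
    (measurable_lintegral_left hw m'), step]
  congr 1
  ext z'
  exact (lintegral_prod_mul hw.of_uncurry_right.aemeasurable
    hw.of_uncurry_right.aemeasurable).symm

theorem map_swap_withDensity (l : Measure S) [SFinite l] {φ : S × S → ℝ≥0∞}
    (hφ : Measurable φ) :
    ((l.prod l).withDensity φ).map Prod.swap = (l.prod l).withDensity fun z => φ z.swap := by
  ext A hA
  rw [Measure.map_apply measurable_swap hA, withDensity_apply _ (measurable_swap hA),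
    withDensity_apply _ hA]
  have := (Measure.measurePreserving_swap (μ := l) (ν := l)).setLIntegral_comp_preimage hA
    (hφ.comp measurable_swap)
  simpa using this

theorem map_swap_step (l : Measure S) [SFinite l] {w : S × S → S × S → ℝ≥0∞}
    (hw : Measurable (Function.uncurry w)) (hsymm : ∀ z z', w z.swap z'.swap = w z z')
    (m : Measure (S × S)) [SFinite m] (hm : m.map Prod.swap = m) :
    (step (l.prod l) w m).map Prod.swap = step (l.prod l) w m := by
  rw [step, map_swap_withDensity l (measurable_lintegral_left hw m)]
  congr 1
  ext z'
  conv_lhs => rw [← hm]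
  rw [lintegral_map hw.of_uncurry_right measurable_swap]
  simp [hsymm]

end Pair

section Coupling

variable {S : Type*}

/-- The pair transitions from `A × A` to `A' × A'` along which both transition densities are at
most `K`. -/
def goodPairs (κ : S → S → ℝ≥0∞) (K : ℝ≥0∞) (A A' : Set S) : Set ((S × S) × (S × S)) :=
  {p | p.1 ∈ A ×ˢ A ∧ p.2 ∈ A' ×ˢ A' ∧ κ p.1.1 p.2.1 ≤ K ∧ κ p.1.2 p.2.2 ≤ K}

/-- The transition density of a pair, discounted by `t` along good transitions. -/
noncomputable def discounted (κ : S → S → ℝ≥0∞) (g : S → ℝ≥0∞) (K : ℝ≥0∞) (A A' : Set S)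
    (t : ℝ≥0∞) (z z' : S × S) : ℝ≥0∞ :=
  t * (goodPairs κ K A A').indicator (Function.uncurry (pairDensity κ g)) (z, z') +
    (goodPairs κ K A A')ᶜ.indicator (Function.uncurry (pairDensity κ g)) (z, z')

/-- The mass that a minorization of the transition density by `ε` on `A × A'` removes from the
transitions of a pair. -/
noncomputable def coupled (g : S → ℝ≥0∞) (ε : ℝ≥0∞) (A A' : Set S) (z z' : S × S) : ℝ≥0∞ :=
  (A ×ˢ A).indicator 1 z * (A' ×ˢ A').indicator (fun z' => ε ^ 2 * (g z'.1 * g z'.2)) z'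

theorem coupled_le_pairDensity {κ : S → S → ℝ≥0∞} (g : S → ℝ≥0∞) {ε : ℝ≥0∞} {A A' : Set S}
    (hmin : ∀ x ∈ A, ∀ x' ∈ A', ε ≤ κ x x') (z z' : S × S) :
    coupled g ε A A' z z' ≤ pairDensity κ g z z' := by
  unfold coupled
  by_cases hz : z ∈ A ×ˢ A
  · by_cases hz' : z' ∈ A' ×ˢ A'
    · rw [Set.indicator_of_mem hz, Set.indicator_of_mem hz', Pi.one_apply, one_mul, pairDensity,
        mul_mul_mul_comm, sq]
      gcongr
      · exact hmin _ hz.1 _ hz'.1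
      · exact hmin _ hz.2 _ hz'.2
    · simp [Set.indicator_of_notMem hz']
  · simp [Set.indicator_of_notMem hz]

theorem pairDensity_sub_coupled_le {κ : S → S → ℝ≥0∞} (g : S → ℝ≥0∞) {ε K ρ : ℝ≥0∞}
    (A A' : Set S) (hρ : ∀ t ≤ K ^ 2, t ≤ ρ * t + ε ^ 2) (z z' : S × S) :
    pairDensity κ g z z' - coupled g ε A A' z z' ≤ discounted κ g K A A' ρ z z' := by
  unfold discounted
  by_cases hz : (z, z') ∈ goodPairs κ K A A'
  · rw [Set.indicator_of_mem hz, Set.indicator_of_notMem (by simpa using hz), add_zero,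
      tsub_le_iff_right]
    obtain ⟨h1, h2, h3, h4⟩ := hz
    rw [coupled, Set.indicator_of_mem h1, Set.indicator_of_mem h2, Function.uncurry,
      pairDensity, mul_mul_mul_comm, Pi.one_apply, one_mul]
    rw [← mul_assoc ρ, ← add_mul]
    refine mul_le_mul_left ?_ _
    refine hρ _ ?_
    rw [sq]
    exact mul_le_mul' h3 h4
  · rw [Set.indicator_of_notMem hz, Set.indicator_of_mem (by simpa using hz)]
    simp [Function.uncurry]

variable [MeasurableSpace S]

theorem measurableSet_goodPairs {κ : S → S → ℝ≥0∞} (hκ : Measurable (Function.uncurry κ))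
    (K : ℝ≥0∞) {A A' : Set S} (hA : MeasurableSet A) (hA' : MeasurableSet A') :
    MeasurableSet (goodPairs κ K A A') := by
  have h1 : Measurable fun p : (S × S) × (S × S) => κ p.1.1 p.2.1 :=
    hκ.comp (f := fun p : (S × S) × (S × S) => (p.1.1, p.2.1)) (by fun_prop)
  have h2 : Measurable fun p : (S × S) × (S × S) => κ p.1.2 p.2.2 :=
    hκ.comp (f := fun p : (S × S) × (S × S) => (p.1.2, p.2.2)) (by fun_prop)
  exact (measurable_fst (hA.prod hA)).inter ((measurable_snd (hA'.prod hA')).inter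
    ((measurableSet_le h1 measurable_const).inter (measurableSet_le h2 measurable_const)))

theorem measurable_discounted {κ : S → S → ℝ≥0∞} {g : S → ℝ≥0∞}
    (hκ : Measurable (Function.uncurry κ)) (hg : Measurable g) (K : ℝ≥0∞) {A A' : Set S}
    (hA : MeasurableSet A) (hA' : MeasurableSet A') (t : ℝ≥0∞) :
    Measurable (Function.uncurry (discounted κ g K A A' t)) := by
  have hG := measurableSet_goodPairs hκ K hA hA'
  have hk := measurable_pairDensity hκ hg
  exact ((hk.indicator hG).const_mul t).add (hk.indicator hG.compl)

theorem step_discounted (l : Measure S) [SFinite l] {κ : S → S → ℝ≥0∞} {g : S → ℝ≥0∞}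
    (hκ : Measurable (Function.uncurry κ)) (hg : Measurable g) (K : ℝ≥0∞) {A A' : Set S}
    (hA : MeasurableSet A) (hA' : MeasurableSet A') (t : ℝ≥0∞) (m : Measure (S × S))
    [SFinite m] :
    step (l.prod l) (discounted κ g K A A' t) m = t • step (l.prod l)
        (fun z z' => (goodPairs κ K A A').indicator (Function.uncurry (pairDensity κ g)) (z, z')) m
      + step (l.prod l) (fun z z' =>
        (goodPairs κ K A A')ᶜ.indicator (Function.uncurry (pairDensity κ g)) (z, z')) m := by
  have hG := measurableSet_goodPairs hκ K hA hA'
  have hk := measurable_pairDensity hκ hg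
  unfold discounted
  rw [step_add_left _ ((hk.indicator hG).const_mul t), step_smul_left _ (w := fun z z' =>
    (goodPairs κ K A A').indicator (Function.uncurry (pairDensity κ g)) (z, z'))
    (hk.indicator hG)]

theorem measurable_coupled {g : S → ℝ≥0∞} (hg : Measurable g) (ε : ℝ≥0∞) {A A' : Set S}
    (hA : MeasurableSet A) (hA' : MeasurableSet A') :
    Measurable (Function.uncurry (coupled g ε A A')) := by
  have h1 : Measurable ((A ×ˢ A).indicator (1 : S × S → ℝ≥0∞)) :=
    measurable_one.indicator (hA.prod hA)
  have h2 : Measurable ((A' ×ˢ A').indicator fun z' : S × S => ε ^ 2 * (g z'.1 * g z'.2)) :=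
    (((hg.comp measurable_fst).mul (hg.comp measurable_snd)).const_mul _).indicator (hA'.prod hA')
  exact (h1.comp measurable_fst).mul (h2.comp measurable_snd)

theorem swap_step_coupled (l : Measure S) [SFinite l] {g : S → ℝ≥0∞} (hg : Measurable g)
    (ε : ℝ≥0∞) {A A' : Set S} (hA : MeasurableSet A) (hA' : MeasurableSet A')
    (m : Measure (S × S)) [SFinite m] :
    (step (l.prod l) (coupled g ε A A') m).map Prod.swap =
      step (l.prod l) (coupled g ε A A') m := by
  have hw := measurable_coupled hg ε hA hA'
  rw [step, map_swap_withDensity l (measurable_lintegral_left hw m)]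
  congr 1
  ext z'
  refine lintegral_congr fun z => ?_
  have h : (A' ×ˢ A').indicator (fun z' : S × S => ε ^ 2 * (g z'.1 * g z'.2)) z'.swap =
      (A' ×ˢ A').indicator (fun z' : S × S => ε ^ 2 * (g z'.1 * g z'.2)) z' := by
    by_cases hz : z' ∈ A' ×ˢ A'
    · have hz' : z'.swap ∈ A' ×ˢ A' := ⟨hz.2, hz.1⟩
      rw [Set.indicator_of_mem hz, Set.indicator_of_mem hz', Prod.fst_swap, Prod.snd_swap,
        mul_comm (g z'.2)]
    · have hz' : z'.swap ∉ A' ×ˢ A' := fun h => hz ⟨h.2, h.1⟩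
      rw [Set.indicator_of_notMem hz, Set.indicator_of_notMem hz']
  rw [coupled, h, coupled]

theorem exists_split_step (l : Measure S) [SFinite l] {κ : S → S → ℝ≥0∞} {g : S → ℝ≥0∞}
    (hκ : Measurable (Function.uncurry κ)) (hg : Measurable g) {ε K ρ θ ϑ : ℝ≥0∞}
    {A A' : Set S} (hA : MeasurableSet A) (hA' : MeasurableSet A')
    (hmin : ∀ x ∈ A, ∀ x' ∈ A', ε ≤ κ x x') (hρ1 : ρ ≤ 1)
    (hρ : ∀ t ≤ K ^ 2, t ≤ ρ * t + ε ^ 2) (hθ : 1 ≤ θ * ϑ)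
    (N D R T : Measure (S × S)) [SFinite N] [SFinite D] [SFinite R] [SFinite T]
    (hN : N = D + R) (hR : R.map Prod.swap = R) (hD : ∀ j : ℕ, D ≤ ρ ^ j • N + θ ^ j • T) :
    ∃ D' R' : Measure (S × S), SFinite D' ∧ SFinite R' ∧
      step (l.prod l) (pairDensity κ g) N = D' + R' ∧ R'.map Prod.swap = R' ∧
      ∀ j : ℕ, D' ≤ ρ ^ j • step (l.prod l) (pairDensity κ g) N +
        θ ^ j • step (l.prod l) (discounted κ g K A A' ϑ) T := by
  have hk := measurable_pairDensity hκ hg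
  have he := measurable_coupled hg ε hA hA'
  have hG := measurableSet_goodPairs hκ K hA hA'
  set r : S × S → S × S → ℝ≥0∞ := fun z z' => pairDensity κ g z z' - coupled g ε A A' z z'
    with hr_def
  have hr : Measurable (Function.uncurry r) := hk.sub he
  have hsum : step (l.prod l) (pairDensity κ g) N = step (l.prod l) r D +
      (step (l.prod l) (coupled g ε A A') D + step (l.prod l) (pairDensity κ g) R) := by
    rw [hN, step_add_right _ hk, ← add_assoc, ← step_add_left _ hr]
    congr 2
    ext z z'
    exact (tsub_add_cancel_of_le (coupled_le_pairDensity g hmin z z')).symm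
  refine ⟨step (l.prod l) r D, step (l.prod l) (coupled g ε A A') D +
    step (l.prod l) (pairDensity κ g) R, inferInstance, inferInstance, hsum, ?_, fun j => ?_⟩
  · rw [Measure.map_add _ _ measurable_swap, swap_step_coupled l hg ε hA hA',
      map_swap_step l hk _ R hR]
    intro z z'
    simp only [pairDensity, Prod.fst_swap, Prod.snd_swap]
    ring
  · cases j with
    | zero =>
      rw [hsum, pow_zero, one_smul]
      exact (Measure.le_add_right le_rfl).trans (Measure.le_add_right le_rfl)
    | succ j =>
      have h1 : step (l.prod l) r D ≤ step (l.prod l) (discounted κ g K A A' ρ) D :=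
        step_mono _ (pairDensity_sub_coupled_le g A A' hρ) le_rfl
      rw [step_discounted l hκ hg K hA hA'] at h1
      rw [step_discounted l hκ hg K hA hA']
      have h2 : step (l.prod l) (pairDensity κ g) N =
          step (l.prod l) (discounted κ g K A A' 1) N := by
        congr 1
        ext z z'
        rw [discounted, one_mul]
        exact (congrFun (Set.indicator_self_add_compl (goodPairs κ K A A')
          (Function.uncurry (pairDensity κ g))) (z, z')).symm
      rw [h2, step_discounted l hκ hg K hA hA', one_smul]
      set kg : S × S → S × S → ℝ≥0∞ := fun z z' =>
        (goodPairs κ K A A').indicator (Function.uncurry (pairDensity κ g)) (z, z')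
      set kb : S × S → S × S → ℝ≥0∞ := fun z z' =>
        (goodPairs κ K A A')ᶜ.indicator (Function.uncurry (pairDensity κ g)) (z, z')
      have hkg : Measurable (Function.uncurry kg) := hk.indicator hG
      have hkb : Measurable (Function.uncurry kb) := hk.indicator hG.compl
      have h3 : step (l.prod l) kg D ≤
          ρ ^ j • step (l.prod l) kg N + θ ^ j • step (l.prod l) kg T := by
        rw [← step_smul_right _ hkg, ← step_smul_right _ hkg, ← step_add_right _ hkg]
        exact step_mono _ (fun _ _ => le_rfl) (hD j)
      have h4 : step (l.prod l) kb D ≤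
          ρ ^ (j + 1) • step (l.prod l) kb N + θ ^ (j + 1) • step (l.prod l) kb T := by
        rw [← step_smul_right _ hkb, ← step_smul_right _ hkb, ← step_add_right _ hkb]
        exact step_mono _ (fun _ _ => le_rfl) (hD (j + 1))
      refine Measure.le_iff'.2 fun s => ?_
      have h1s := h1 s
      have h3s := h3 s
      have h4s := h4 s
      simp only [Measure.add_apply, Measure.smul_apply, smul_eq_mul] at h1s h3s h4s ⊢
      have h5 : ρ * (θ ^ j * step (l.prod l) kg T s) ≤
          θ ^ (j + 1) * (ϑ * step (l.prod l) kg T s) := by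
        calc ρ * (θ ^ j * step (l.prod l) kg T s) ≤ 1 * (θ ^ j * step (l.prod l) kg T s) := by
              gcongr
          _ = θ ^ j * 1 * step (l.prod l) kg T s := by ring
          _ ≤ θ ^ j * (θ * ϑ) * step (l.prod l) kg T s := by gcongr
          _ = _ := by ring
      calc _ ≤ _ := h1s
        _ ≤ ρ * (ρ ^ j * step (l.prod l) kg N s + θ ^ j * step (l.prod l) kg T s) +
            (ρ ^ (j + 1) * step (l.prod l) kb N s + θ ^ (j + 1) * step (l.prod l) kb T s) := by
          gcongr
        _ = ρ ^ (j + 1) * (step (l.prod l) kg N s + step (l.prod l) kb N s) +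
            (ρ * (θ ^ j * step (l.prod l) kg T s) + θ ^ (j + 1) * step (l.prod l) kb T s) := by
          ring
        _ ≤ ρ ^ (j + 1) * (step (l.prod l) kg N s + step (l.prod l) kb N s) +
            (θ ^ (j + 1) * (ϑ * step (l.prod l) kg T s) +
              θ ^ (j + 1) * step (l.prod l) kb T s) := by gcongr
        _ = _ := by ring

end Coupling

section Potential

variable {S : Type*}

open Classical in
/-- The function equal to `1` on `A × A` and to `1 + c` elsewhere. -/
noncomputable def potential (c : ℝ≥0∞) (A : Set S) (z : S × S) : ℝ≥0∞ :=
  if z ∈ A ×ˢ A then 1 else 1 + c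

theorem one_le_potential (c : ℝ≥0∞) (A : Set S) (z : S × S) : 1 ≤ potential c A z := by
  unfold potential
  split_ifs
  · exact le_rfl
  · exact le_self_add

theorem potential_le (c : ℝ≥0∞) (A : Set S) (z : S × S) : potential c A z ≤ 1 + c := by
  unfold potential
  split_ifs
  · exact le_self_add
  · exact le_rfl

theorem mul_potential_le {g : S → ℝ≥0∞} {A : Set S} {B η : ℝ≥0∞} (c : ℝ≥0∞)
    (hB : ∀ x, g x ≤ B) (hη : ∀ x, x ∉ A → g x ≤ η * B) (z : S × S) (hz : z ∉ A ×ˢ A) :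
    g z.1 * g z.2 * potential c A z ≤ B ^ 2 * (η * (1 + c)) := by
  have h : g z.1 * g z.2 ≤ η * B ^ 2 := by
    by_cases h1 : z.1 ∈ A
    · have h2 : z.2 ∉ A := fun h2 => hz ⟨h1, h2⟩
      calc g z.1 * g z.2 ≤ B * (η * B) := mul_le_mul' (hB _) (hη _ h2)
        _ = _ := by ring
    · calc g z.1 * g z.2 ≤ (η * B) * B := mul_le_mul' (hη _ h1) (hB _)
        _ = _ := by ring
  calc g z.1 * g z.2 * potential c A z ≤ η * B ^ 2 * (1 + c) :=
        mul_le_mul' h (potential_le _ _ _)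
    _ = _ := by ring

theorem discounted_le_pairDensity (κ : S → S → ℝ≥0∞) (g : S → ℝ≥0∞) (K : ℝ≥0∞) (A A' : Set S)
    {t : ℝ≥0∞} (ht : t ≤ 1) (z z' : S × S) :
    discounted κ g K A A' t z z' ≤ pairDensity κ g z z' := by
  unfold discounted
  by_cases hz : (z, z') ∈ goodPairs κ K A A'
  · rw [Set.indicator_of_mem hz, Set.indicator_of_notMem (by simpa using hz), add_zero]
    exact mul_le_of_le_one_left' ht
  · rw [Set.indicator_of_notMem hz, Set.indicator_of_mem (by simpa using hz), mul_zero, zero_add]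
    exact le_rfl

theorem discounted_mul_potential_le (κ : S → S → ℝ≥0∞) {g : S → ℝ≥0∞} {A A' : Set S}
    {B η : ℝ≥0∞} (K c : ℝ≥0∞) {t : ℝ≥0∞} (ht : t ≤ 1)
    (hB : ∀ x, g x ≤ B) (hη : ∀ x, x ∉ A' → g x ≤ η * B) (z z' : S × S) :
    discounted κ g K A A' t z z' * potential c A' z' ≤
      B ^ 2 * (1 + η * (1 + c)) * (κ z.1 z'.1 * κ z.2 z'.2) := by
  have h : g z'.1 * g z'.2 * potential c A' z' ≤ B ^ 2 * (1 + η * (1 + c)) := by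
    by_cases hz : z' ∈ A' ×ˢ A'
    · rw [potential, if_pos hz, mul_one, sq]
      exact (mul_le_mul' (hB _) (hB _)).trans (le_mul_of_one_le_right' le_self_add)
    · refine (mul_potential_le c hB hη z' hz).trans ?_
      gcongr
      exact le_add_self
  calc discounted κ g K A A' t z z' * potential c A' z'
      ≤ pairDensity κ g z z' * potential c A' z' := by
        gcongr; exact discounted_le_pairDensity κ g K A A' ht z z'
    _ = (κ z.1 z'.1 * κ z.2 z'.2) * (g z'.1 * g z'.2 * potential c A' z') := by
        rw [pairDensity]; ring
    _ ≤ (κ z.1 z'.1 * κ z.2 z'.2) * (B ^ 2 * (1 + η * (1 + c))) := by gcongr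
    _ = _ := mul_comm _ _

theorem discounted_mul_potential_le_of_mem (κ : S → S → ℝ≥0∞) {g : S → ℝ≥0∞} {A A' : Set S}
    {B η : ℝ≥0∞} (K c : ℝ≥0∞) {t : ℝ≥0∞} (ht : t ≤ 1)
    (hB : ∀ x, g x ≤ B) (hη : ∀ x, x ∉ A' → g x ≤ η * B) {z : S × S} (hz : z ∈ A ×ˢ A)
    (z' : S × S) :
    discounted κ g K A A' t z z' * potential c A' z' ≤
      B ^ 2 * ((t + η * (1 + c)) * (κ z.1 z'.1 * κ z.2 z'.2) +
        {x | K < κ z.1 x}.indicator (κ z.1) z'.1 * κ z.2 z'.2 +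
        κ z.1 z'.1 * {x | K < κ z.2 x}.indicator (κ z.2) z'.2) := by
  by_cases hz' : z' ∈ A' ×ˢ A'
  · have hpot : potential c A' z' = 1 := if_pos hz'
    have hg : g z'.1 * g z'.2 ≤ B ^ 2 := by rw [sq]; exact mul_le_mul' (hB _) (hB _)
    have hle : pairDensity κ g z z' ≤ B ^ 2 * (κ z.1 z'.1 * κ z.2 z'.2) := by
      rw [pairDensity, mul_mul_mul_comm, mul_comm]
      gcongr
    by_cases hp : (z, z') ∈ goodPairs κ K A A'
    · rw [hpot, mul_one, discounted, Set.indicator_of_mem hp,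
        Set.indicator_of_notMem (by simpa using hp), add_zero]
      calc t * Function.uncurry (pairDensity κ g) (z, z')
          ≤ t * (B ^ 2 * (κ z.1 z'.1 * κ z.2 z'.2)) := by gcongr; exact hle
        _ = B ^ 2 * (t * (κ z.1 z'.1 * κ z.2 z'.2)) := by ring
        _ ≤ _ := by
          gcongr
          refine le_trans ?_ le_self_add
          refine le_trans ?_ le_self_add
          gcongr
          exact le_self_add
    · rw [hpot, mul_one]
      refine ((discounted_le_pairDensity κ g K A A' ht z z').trans hle).trans ?_
      gcongr
      by_cases h1 : K < κ z.1 z'.1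
      · have : z'.1 ∈ {x | K < κ z.1 x} := h1
        rw [Set.indicator_of_mem this]
        exact le_trans le_add_self le_self_add
      · have h2 : K < κ z.2 z'.2 := by
          by_contra h2
          exact hp ⟨hz, hz', not_lt.1 h1, not_lt.1 h2⟩
        have : z'.2 ∈ {x | K < κ z.2 x} := h2
        rw [Set.indicator_of_mem this]
        exact le_add_self
  · calc discounted κ g K A A' t z z' * potential c A' z'
        ≤ pairDensity κ g z z' * potential c A' z' := by
          gcongr; exact discounted_le_pairDensity κ g K A A' ht z z'
      _ = (κ z.1 z'.1 * κ z.2 z'.2) * (g z'.1 * g z'.2 * potential c A' z') := by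
          rw [pairDensity]; ring
      _ ≤ (κ z.1 z'.1 * κ z.2 z'.2) * (B ^ 2 * (η * (1 + c))) := by
          exact mul_le_mul' le_rfl (mul_potential_le c hB hη z' hz')
      _ = B ^ 2 * (η * (1 + c) * (κ z.1 z'.1 * κ z.2 z'.2)) := by ring
      _ ≤ _ := by
          gcongr
          refine le_trans ?_ le_self_add
          refine le_trans ?_ le_self_add
          gcongr
          exact le_add_self

variable [MeasurableSpace S]

theorem measurable_potential (c : ℝ≥0∞) {A : Set S} (hA : MeasurableSet A) :
    Measurable (potential c A) :=
  Measurable.ite (hA.prod hA) measurable_const measurable_const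

theorem lintegral_discounted_mul_potential_le (l : Measure S) [SFinite l]
    {κ : S → S → ℝ≥0∞} (hκ : Measurable (Function.uncurry κ)) {g : S → ℝ≥0∞} {A A' : Set S}
    {B η : ℝ≥0∞} (K c : ℝ≥0∞) {t : ℝ≥0∞} (ht : t ≤ 1) (hκ1 : ∀ x, ∫⁻ x', κ x x' ∂l ≤ 1)
    (hB : ∀ x, g x ≤ B) (hη : ∀ x, x ∉ A' → g x ≤ η * B) (z : S × S) :
    ∫⁻ z', discounted κ g K A A' t z z' * potential c A' z' ∂l.prod l ≤
      B ^ 2 * (1 + η * (1 + c)) := by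
  have hk : ∀ x, Measurable (κ x) := fun x => hκ.of_uncurry_left
  calc _ ≤ ∫⁻ z', B ^ 2 * (1 + η * (1 + c)) * (κ z.1 z'.1 * κ z.2 z'.2) ∂l.prod l :=
        lintegral_mono fun z' => discounted_mul_potential_le κ K c ht hB hη z z'
    _ = B ^ 2 * (1 + η * (1 + c)) * ((∫⁻ x, κ z.1 x ∂l) * ∫⁻ x, κ z.2 x ∂l) := by
        rw [lintegral_const_mul _ (show Measurable fun z' : S × S => κ z.1 z'.1 * κ z.2 z'.2 from
            ((hk _).comp measurable_fst).mul ((hk _).comp measurable_snd)),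
          lintegral_prod_mul (hk _).aemeasurable (hk _).aemeasurable]
    _ ≤ B ^ 2 * (1 + η * (1 + c)) * (1 * 1) := by gcongr <;> exact hκ1 _
    _ = _ := by simp

theorem lintegral_discounted_mul_potential_le_of_mem (l : Measure S) [SFinite l]
    {κ : S → S → ℝ≥0∞} (hκ : Measurable (Function.uncurry κ)) {g : S → ℝ≥0∞} {A A' : Set S}
    {B η δ : ℝ≥0∞} (K c : ℝ≥0∞) {t : ℝ≥0∞} (ht : t ≤ 1) (hκ1 : ∀ x, ∫⁻ x', κ x x' ∂l ≤ 1)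
    (hδ : ∀ x, ∫⁻ x' in {x' | K < κ x x'}, κ x x' ∂l ≤ δ)
    (hB : ∀ x, g x ≤ B) (hη : ∀ x, x ∉ A' → g x ≤ η * B) {z : S × S} (hz : z ∈ A ×ˢ A) :
    ∫⁻ z', discounted κ g K A A' t z z' * potential c A' z' ∂l.prod l ≤
      B ^ 2 * (t + η * (1 + c) + δ + δ) := by
  have hk : ∀ x, Measurable (κ x) := fun x => hκ.of_uncurry_left
  have hK : ∀ x, MeasurableSet {x' | K < κ x x'} :=
    fun x => measurableSet_lt measurable_const (hk x)
  have hi : ∀ x, Measurable ({x' | K < κ x x'}.indicator (κ x)) := fun x => (hk x).indicator (hK x)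
  have hδ' : ∀ x, ∫⁻ x', {x' | K < κ x x'}.indicator (κ x) x' ∂l ≤ δ := fun x => by
    rw [lintegral_indicator (hK x)]
    exact hδ x
  have hm : ∀ {φ φ' : S → ℝ≥0∞}, Measurable φ → Measurable φ' →
      Measurable fun z' : S × S => φ z'.1 * φ' z'.2 :=
    fun h h' => (h.comp measurable_fst).mul (h'.comp measurable_snd)
  have h1 : Measurable fun z' : S × S => (t + η * (1 + c)) * (κ z.1 z'.1 * κ z.2 z'.2) :=
    (hm (hk _) (hk _)).const_mul _
  have h12 : Measurable fun z' : S × S => (t + η * (1 + c)) * (κ z.1 z'.1 * κ z.2 z'.2) +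
      {x | K < κ z.1 x}.indicator (κ z.1) z'.1 * κ z.2 z'.2 := h1.add (hm (hi _) (hk _))
  have h123 : Measurable fun z' : S × S => (t + η * (1 + c)) * (κ z.1 z'.1 * κ z.2 z'.2) +
      {x | K < κ z.1 x}.indicator (κ z.1) z'.1 * κ z.2 z'.2 +
      κ z.1 z'.1 * {x | K < κ z.2 x}.indicator (κ z.2) z'.2 := h12.add (hm (hk _) (hi _))
  calc _ ≤ ∫⁻ z', B ^ 2 * ((t + η * (1 + c)) * (κ z.1 z'.1 * κ z.2 z'.2) +
        {x | K < κ z.1 x}.indicator (κ z.1) z'.1 * κ z.2 z'.2 +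
        κ z.1 z'.1 * {x | K < κ z.2 x}.indicator (κ z.2) z'.2) ∂l.prod l :=
        lintegral_mono fun z' => discounted_mul_potential_le_of_mem κ K c ht hB hη hz z'
    _ = B ^ 2 * ((t + η * (1 + c)) * ((∫⁻ x, κ z.1 x ∂l) * ∫⁻ x, κ z.2 x ∂l) +
        (∫⁻ x', {x | K < κ z.1 x}.indicator (κ z.1) x' ∂l) * (∫⁻ x, κ z.2 x ∂l) +
        (∫⁻ x, κ z.1 x ∂l) * ∫⁻ x', {x | K < κ z.2 x}.indicator (κ z.2) x' ∂l) := by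
        rw [lintegral_const_mul _ h123, lintegral_add_left h12, lintegral_add_left h1,
          lintegral_const_mul _ (hm (hk _) (hk _)),
          lintegral_prod_mul (hk _).aemeasurable (hk _).aemeasurable,
          lintegral_prod_mul (hi _).aemeasurable (hk _).aemeasurable,
          lintegral_prod_mul (hk _).aemeasurable (hi _).aemeasurable]
    _ ≤ B ^ 2 * ((t + η * (1 + c)) * (1 * 1) + δ * 1 + 1 * δ) := by
        gcongr <;> first | exact hκ1 _ | exact hδ' _
    _ = _ := by simp

end Potential

section Iterate

variable {S : Type*} [MeasurableSpace S]

open Classical in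
/-- The pair measure of two weighted chains started from different laws splits, at every time,
into a part that is invariant under the swap and a part whose mass is controlled by the minorization
of the transition density at the times in `J`. -/
theorem exists_split (l : Measure S) [SFinite l] {κ : S → S → ℝ≥0∞}
    (hκ : Measurable (Function.uncurry κ)) (hκ1 : ∀ x, ∫⁻ x', κ x x' ∂l ≤ 1)
    {g : ℕ → S → ℝ≥0∞} (hg : ∀ i, Measurable (g i)) {C : ℕ → Set S}
    (hC : ∀ i, MeasurableSet (C i)) (J : Set ℕ) {ε K ρ θ ϑ B η δ τ c : ℝ≥0∞}
    (hmin : ∀ i ∈ J, ∀ x ∈ C i, ∀ x' ∈ C (i + 1), ε ≤ κ x x') (hρ1 : ρ ≤ 1)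
    (hρ : ∀ t ≤ K ^ 2, t ≤ ρ * t + ε ^ 2) (hθ : 1 ≤ θ * ϑ) (hϑ : ϑ ≤ 1)
    (hδ : ∀ x, ∫⁻ x' in {x' | K < κ x x'}, κ x x' ∂l ≤ δ)
    (hB : ∀ i x, g i x ≤ B) (hη : ∀ i x, x ∉ C i → g i x ≤ η * B)
    (hη1 : η * (1 + c) ≤ 1) (hc : 2 ≤ τ * (1 + c)) (hτ : ϑ + η * (1 + c) + δ + δ ≤ τ)
    {μ μ' : ℕ → Measure S} [SFinite (μ 0)] [SFinite (μ' 0)]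
    (hμ : ∀ k, μ (k + 1) = step l (fun x x' => κ x x' * g (k + 1) x') (μ k))
    (hμ' : ∀ k, μ' (k + 1) = step l (fun x x' => κ x x' * g (k + 1) x') (μ' k)) (k : ℕ) :
    ∃ D R T : Measure (S × S), SFinite D ∧ SFinite R ∧ SFinite T ∧
      (μ k).prod (μ' k) = D + R ∧ R.map Prod.swap = R ∧
      (∀ j : ℕ, D ≤ ρ ^ j • (μ k).prod (μ' k) + θ ^ j • T) ∧
      ∫⁻ z, potential c (C k) z ∂T ≤
        (∏ i ∈ Finset.range k, (B ^ 2 * if i ∈ J then τ else 2)) *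
          ((1 + c) * ((μ 0 Set.univ) * μ' 0 Set.univ)) := by
  have hs : ∀ k, SFinite (μ k) := fun k => by
    cases k with
    | zero => infer_instance
    | succ k => rw [hμ]; infer_instance
  have hs' : ∀ k, SFinite (μ' k) := fun k => by
    cases k with
    | zero => infer_instance
    | succ k => rw [hμ']; infer_instance
  induction k with
  | zero =>
    refine ⟨(μ 0).prod (μ' 0), 0, (μ 0).prod (μ' 0), inferInstance, inferInstance, inferInstance,
      by simp, by simp, fun j => ?_, ?_⟩
    · have h1 : (1 : ℝ≥0∞) ≤ θ ^ j := one_le_pow₀ (hθ.trans (mul_le_of_le_one_right' hϑ))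
      refine le_trans ?_ (Measure.le_add_left le_rfl)
      refine Measure.le_iff'.2 fun s => ?_
      rw [Measure.smul_apply, smul_eq_mul]
      exact le_mul_of_one_le_left' h1
    · calc _ ≤ ∫⁻ z, 1 + c ∂(μ 0).prod (μ' 0) := lintegral_mono fun z => potential_le _ _ _
        _ = _ := by simp [← Set.univ_prod_univ, Measure.prod_prod]
  | succ k ih =>
    obtain ⟨D, R, T, hDf, hRf, hTf, hN, hR, hD, hT⟩ := ih
    have := hs k
    have := hs' k
    set A : Set S := if k ∈ J then C k else ∅ with hA_def
    have hA : MeasurableSet A := by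
      rw [hA_def]; split_ifs
      exacts [hC k, MeasurableSet.empty]
    have hminA : ∀ x ∈ A, ∀ x' ∈ C (k + 1), ε ≤ κ x x' := by
      intro x hx
      by_cases hk : k ∈ J
      · rw [hA_def, if_pos hk] at hx
        exact hmin k hk x hx
      · rw [hA_def, if_neg hk] at hx
        exact hx.elim
    obtain ⟨D', R', hDf', hRf', hN', hR', hD'⟩ := exists_split_step l hκ (hg (k + 1)) hA (hC (k + 1))
      hminA hρ1 hρ hθ ((μ k).prod (μ' k)) D R T hN hR hD
    refine ⟨D', R', step (l.prod l) (discounted κ (g (k + 1)) K A (C (k + 1)) ϑ) T, hDf', hRf',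
      inferInstance, ?_, hR', ?_, ?_⟩
    · rw [hμ, hμ', prod_step l hκ (hg (k + 1)), hN']
    · rw [hμ, hμ', prod_step l hκ (hg (k + 1))]
      exact hD'
    · rw [lintegral_step _ (measurable_discounted hκ (hg (k + 1)) K hA (hC (k + 1)) ϑ) _
        (measurable_potential c (hC (k + 1))), Finset.prod_range_succ]
      have hpt : ∀ z, ∫⁻ z', discounted κ (g (k + 1)) K A (C (k + 1)) ϑ z z' *
          potential c (C (k + 1)) z' ∂l.prod l ≤
          (B ^ 2 * if k ∈ J then τ else 2) * potential c (C k) z := by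
        intro z
        have hgen := lintegral_discounted_mul_potential_le (A := A) l hκ K c hϑ hκ1 (hB (k + 1))
          (hη (k + 1)) z
        have h2 : B ^ 2 * (1 + η * (1 + c)) ≤ B ^ 2 * 2 := by
          gcongr
          rw [← one_add_one_eq_two]
          gcongr
        by_cases hk : k ∈ J
        · rw [if_pos hk]
          by_cases hz : z ∈ C k ×ˢ C k
          · have hzA : z ∈ A ×ˢ A := by rwa [hA_def, if_pos hk]
            refine (lintegral_discounted_mul_potential_le_of_mem l hκ K c hϑ hκ1 hδ (hB (k + 1))
              (hη (k + 1)) hzA).trans ?_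
            rw [potential, if_pos hz, mul_one]
            gcongr
          · rw [potential, if_neg hz, mul_assoc]
            refine (hgen.trans h2).trans ?_
            gcongr
        · rw [if_neg hk]
          exact (hgen.trans h2).trans (le_mul_of_one_le_right' (one_le_potential _ _ _))
      calc _ ≤ ∫⁻ z, (B ^ 2 * if k ∈ J then τ else 2) * potential c (C k) z ∂T :=
            lintegral_mono hpt
        _ = (B ^ 2 * if k ∈ J then τ else 2) * ∫⁻ z, potential c (C k) z ∂T :=
            lintegral_const_mul _ (measurable_potential c (hC k))
        _ ≤ (B ^ 2 * if k ∈ J then τ else 2) *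
            ((∏ i ∈ Finset.range k, (B ^ 2 * if i ∈ J then τ else 2)) *
              ((1 + c) * ((μ 0 Set.univ) * μ' 0 Set.univ))) := by gcongr
        _ = _ := by ring

/-- The total variation distance of two normalized measures is controlled by the part of their
product that is not invariant under the swap. -/
theorem tv_normalized_le (μ μ' : Measure S) [IsFiniteMeasure μ] [IsFiniteMeasure μ']
    (h0 : μ Set.univ ≠ 0) (h0' : μ' Set.univ ≠ 0) {D R : Measure (S × S)}
    (hN : μ.prod μ' = D + R) (hR : R.map Prod.swap = R) :
    tv ((μ Set.univ)⁻¹ • μ) ((μ' Set.univ)⁻¹ • μ') ≤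
      D Set.univ / (μ Set.univ * μ' Set.univ) := by
  refine iSup₂_le fun A hA => ?_
  have hRA : R (Set.univ ×ˢ A) = R (A ×ˢ Set.univ) := by
    conv_lhs => rw [← hR]
    rw [Measure.map_apply measurable_swap (MeasurableSet.univ.prod hA), Set.preimage_swap_prod]
  have hA1 : μ A * μ' Set.univ = D (A ×ˢ Set.univ) + R (A ×ˢ Set.univ) := by
    rw [← Measure.prod_prod, hN, Measure.add_apply]
  have hA2 : μ Set.univ * μ' A = D (Set.univ ×ˢ A) + R (A ×ˢ Set.univ) := by
    rw [← hRA, ← Measure.prod_prod, hN, Measure.add_apply]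
  have hDle : D Set.univ ≤ μ Set.univ * μ' Set.univ := by
    rw [← Measure.prod_prod, Set.univ_prod_univ, hN, Measure.add_apply]
    exact le_self_add
  have hDtop : D Set.univ ≠ ∞ :=
    ne_top_of_le_ne_top (ENNReal.mul_ne_top (measure_ne_top _ _) (measure_ne_top _ _)) hDle
  have h1 : μ A * μ' Set.univ ≤ D Set.univ + μ Set.univ * μ' A := by
    rw [hA1, hA2]
    exact add_le_add (measure_mono (Set.subset_univ _)) le_add_self
  have h2 : μ Set.univ * μ' A ≤ D Set.univ + μ A * μ' Set.univ := by
    rw [hA1, hA2]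
    exact add_le_add (measure_mono (Set.subset_univ _)) le_add_self
  have h1r := ENNReal.toReal_mono (by finiteness) h1
  have h2r := ENNReal.toReal_mono (by finiteness) h2
  rw [ENNReal.toReal_add hDtop (by finiteness), ENNReal.toReal_mul, ENNReal.toReal_mul] at h1r h2r
  have hp : 0 < (μ Set.univ).toReal := ENNReal.toReal_pos h0 (measure_ne_top _ _)
  have hp' : 0 < (μ' Set.univ).toReal := ENNReal.toReal_pos h0' (measure_ne_top _ _)
  refine ENNReal.ofReal_le_of_le_toReal ?_
  simp only [Measure.real, Measure.smul_apply, smul_eq_mul, ENNReal.toReal_mul, ENNReal.toReal_inv,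
    ENNReal.toReal_div]
  rw [abs_le, inv_mul_eq_div, inv_mul_eq_div, div_sub_div _ _ hp.ne' hp'.ne', ← neg_div]
  constructor
  · gcongr
    linarith
  · gcongr
    linarith

end Iterate

section Averages

variable {Ω : Type*}

theorem sum_range_two_mul {M : Type*} [AddCommMonoid M] (u : ℕ → M) (k : ℕ) :
    ∑ i ∈ Finset.range (2 * k), u i =
      ∑ j ∈ Finset.range k, u (2 * j) + ∑ j ∈ Finset.range k, u (2 * j + 1) := by
  induction k with
  | zero => simp
  | succ k ih =>
    rw [Nat.mul_succ, Finset.sum_range_succ, Finset.sum_range_succ, ih, Finset.sum_range_succ,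
      Finset.sum_range_succ]
    abel

theorem sum_trunc_sq_le_real (t : ℝ) (ht : 0 ≤ t) (n : ℕ) :
    ∑ m ∈ Finset.range n, min t (2 ^ m) ^ 2 / 2 ^ m ≤ 2 ^ n ∧
      (t ≤ 2 ^ n → ∑ m ∈ Finset.range n, min t (2 ^ m) ^ 2 / 2 ^ m + 2 * t ^ 2 / 2 ^ n ≤ 4 * t) := by
  induction n with
  | zero =>
    refine ⟨by simp, fun h => ?_⟩
    simp only [pow_zero] at h
    simp only [Finset.range_zero, Finset.sum_empty, pow_zero, div_one]
    nlinarith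
  | succ n ih =>
    obtain ⟨h1, h2⟩ := ih
    rw [Finset.sum_range_succ]
    have hp : (0 : ℝ) < 2 ^ n := by positivity
    rcases le_total t (2 ^ n) with h | h
    · have h2 := h2 h
      rw [min_eq_left h]
      have h3 : 2 * t ^ 2 / 2 ^ (n + 1) = t ^ 2 / 2 ^ n := by rw [pow_succ (2 : ℝ) n]; field_simp
      have h4 : 2 * t ^ 2 / 2 ^ n = t ^ 2 / 2 ^ n + t ^ 2 / 2 ^ n := by ring
      refine ⟨?_, fun _ => by rw [h3]; linarith⟩
      have h5 : t ^ 2 / 2 ^ n ≤ 2 ^ n := by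
        rw [div_le_iff₀ hp, sq]
        exact mul_le_mul h h ht hp.le
      rw [pow_succ (2 : ℝ) n]; linarith
    · rw [min_eq_right h]
      have h3 : ((2 : ℝ) ^ n) ^ 2 / 2 ^ n = 2 ^ n := by field_simp
      rw [h3, pow_succ (2 : ℝ) n]
      refine ⟨by linarith, fun h4 => ?_⟩
      have h5 : 2 * t ^ 2 / (2 ^ n * 2) ≤ 4 * t - 2 * 2 ^ n := by
        rw [div_le_iff₀ (by positivity)]
        nlinarith
      linarith

theorem tsum_trunc_sq_le (t : ℝ≥0∞) : ∑' m : ℕ, min t (2 ^ m) ^ 2 / 2 ^ m ≤ 4 * t := by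
  rcases eq_or_ne t ∞ with rfl | ht
  · simp
  · lift t to ℝ≥0 using ht
    refine ENNReal.tsum_le_of_sum_range_le fun n => ?_
    have h := (sum_trunc_sq_le_real t t.2 (n + ⌈(t : ℝ)⌉₊))
    have h2 := h.2 (by
      calc (t : ℝ) ≤ (⌈(t : ℝ)⌉₊ : ℝ) := Nat.le_ceil _
        _ ≤ (2 : ℝ) ^ ⌈(t : ℝ)⌉₊ := by exact_mod_cast Nat.lt_two_pow_self.le
        _ ≤ _ := pow_le_pow_right₀ (by norm_num) (by omega))
    have h3 : ∑ m ∈ Finset.range n, min (t : ℝ) (2 ^ m) ^ 2 / 2 ^ m ≤ 4 * (t : ℝ) := by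
      refine le_trans (Finset.sum_le_sum_of_subset_of_nonneg (Finset.range_mono (by omega))
        fun _ _ _ => by positivity) (le_trans (le_add_of_nonneg_right ?_) h2)
      positivity
    have h4 : ∑ m ∈ Finset.range n, min t (2 ^ m) ^ 2 / 2 ^ m ≤ 4 * t := by
      rw [← NNReal.coe_le_coe]
      push_cast
      exact h3
    have h5 : ∀ m : ℕ, min (t : ℝ≥0∞) (2 ^ m) ^ 2 / 2 ^ m =
        ((min t (2 ^ m) ^ 2 / 2 ^ m : ℝ≥0) : ℝ≥0∞) := fun m => by
      rw [ENNReal.coe_div (by positivity)]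
      push_cast
      rfl
    rw [Finset.sum_congr rfl fun m _ => h5 m]
    exact_mod_cast h4

theorem tsub_sq_add_le {u t θ : ℝ≥0∞} (hu : u ≠ ∞) (ht : t ≠ ∞) (hθ : θ ≠ ∞) :
    (u + t - θ) ^ 2 + 2 * (u * θ) ≤ u ^ 2 + 2 * (u * t) + t ^ 2 + θ ^ 2 := by
  lift u to ℝ≥0 using hu
  lift t to ℝ≥0 using ht
  lift θ to ℝ≥0 using hθ
  norm_cast
  rcases le_total θ (u + t) with h | h
  · rw [← NNReal.coe_le_coe]
    push_cast [NNReal.coe_sub h]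
    nlinarith [t.2, θ.2, mul_nonneg t.2 θ.2]
  · rw [tsub_eq_zero_of_le h, ← NNReal.coe_le_coe]
    push_cast
    nlinarith [u.2, t.2, θ.2, mul_nonneg u.2 t.2, sq_nonneg ((u : ℝ) - θ)]

theorem lintegral_sq_le {F : Type*} [MeasurableSpace F] (π : Measure F) [IsProbabilityMeasure π]
    {f : F → ℝ≥0∞} (hf : Measurable f) : (∫⁻ u, f u ∂π) ^ 2 ≤ ∫⁻ u, f u ^ 2 ∂π := by
  have h := ENNReal.lintegral_mul_le_Lp_mul_Lq π Real.HolderConjugate.two_two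
    hf.aemeasurable (aemeasurable_const (b := (1 : ℝ≥0∞)))
  simp only [Pi.mul_apply, mul_one, ENNReal.one_rpow, lintegral_one, measure_univ] at h
  have h2 : ∫⁻ u, f u ^ (2 : ℝ) ∂π = ∫⁻ u, f u ^ 2 ∂π := by simp
  rw [h2] at h
  calc (∫⁻ u, f u ∂π) ^ 2 ≤ ((∫⁻ u, f u ^ 2 ∂π) ^ (1 / 2 : ℝ)) ^ 2 := by gcongr
    _ = _ := by rw [← ENNReal.rpow_natCast, ← ENNReal.rpow_mul]; norm_num

/-- Averages of a non-negative integrable function of consecutive terms of an i.i.d. sequence are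
almost surely bounded. -/
theorem ae_sum_consecutive_le [MeasurableSpace Ω] {P : Measure Ω} [IsProbabilityMeasure P]
    {F : Type*} [MeasurableSpace F] {ε : ℕ → Ω → F} (hε : ∀ k, Measurable (ε k))
    (hind : iIndepFun ε P) (hid : ∀ k, IdentDistrib (ε k) (ε 0) P P) {f : F × F → ℝ≥0∞}
    (hf : Measurable f) (hfin : ∫⁻ ω, f (ε 0 ω, ε 1 ω) ∂P ≠ ∞) :
    ∀ᵐ ω ∂P, ∃ L : ℝ≥0, ∀ᶠ k : ℕ in atTop,
      ∑ i ∈ Finset.range k, f (ε i ω, ε (i + 1) ω) ≤ L * k := by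
  have hpair : ∀ i, IdentDistrib (fun ω => (ε i ω, ε (i + 1) ω)) (fun ω => (ε 0 ω, ε 1 ω)) P P :=
    fun i => by
      refine IdentDistrib.prodMk (hid i) ((hid (i + 1)).trans (hid 1).symm) ?_ ?_
      · exact hind.indepFun (by omega)
      · exact hind.indepFun (by omega)
  have hae0 : ∀ᵐ ω ∂P, f (ε 0 ω, ε 1 ω) < ∞ :=
    ae_lt_top (hf.comp ((hε 0).prodMk (hε 1))) hfin
  have hae : ∀ᵐ ω ∂P, ∀ i, f (ε i ω, ε (i + 1) ω) < ∞ := by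
    rw [ae_all_iff]
    intro i
    exact (hpair i).symm.ae_snd (p := fun z => f z < ∞) (measurableSet_lt hf measurable_const) hae0
  have hmeas : ∀ i, Measurable fun ω => (f (ε i ω, ε (i + 1) ω)).toReal := fun i =>
    (hf.comp ((hε i).prodMk (hε (i + 1)))).ennreal_toReal
  have key : ∀ r : ℕ, ∀ᵐ ω ∂P, ∃ L : ℝ≥0, ∀ᶠ k : ℕ in atTop,
      ∑ j ∈ Finset.range k, f (ε (2 * j + r) ω, ε (2 * j + r + 1) ω) ≤ L * k := by
    intro r
    have hslln := strong_law_ae_real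
      (fun (j : ℕ) (ω : Ω) => (f (ε (2 * j + r) ω, ε (2 * j + r + 1) ω)).toReal) (μ := P) ?_ ?_ ?_
    · filter_upwards [hslln, hae] with ω hω hfinω
      set c := P[fun ω => (f (ε (2 * 0 + r) ω, ε (2 * 0 + r + 1) ω)).toReal] with hc
      have hc0 : 0 ≤ c := integral_nonneg fun _ => ENNReal.toReal_nonneg
      refine ⟨⟨c + 1, by linarith⟩, ?_⟩
      filter_upwards [hω.eventually_lt_const (lt_add_one c), eventually_gt_atTop 0] with k hk hk0
      have hk0' : (0 : ℝ) < k := by exact_mod_cast hk0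
      rw [div_lt_iff₀ hk0', ← ENNReal.toReal_sum fun j _ => (hfinω _).ne] at hk
      refine (ENNReal.le_ofReal_iff_toReal_le ?_ (by positivity)).2 hk.le |>.trans (le_of_eq ?_)
      · exact ENNReal.sum_ne_top.2 fun j _ => (hfinω _).ne
      · rw [ENNReal.ofReal_mul (by linarith), ENNReal.ofReal_natCast]
        congr 1
        exact ENNReal.ofReal_eq_coe_nnreal (by linarith)
    · refine integrable_toReal_of_lintegral_ne_top
        (hf.comp ((hε _).prodMk (hε _))).aemeasurable ?_
      have := ((hpair (2 * 0 + r)).comp hf).lintegral_eq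
      simp only [Function.comp_def] at this
      rw [this]
      exact hfin
    · intro i j hij
      have h := hind.indepFun_prodMk_prodMk hε (2 * i + r) (2 * i + r + 1) (2 * j + r)
        (2 * j + r + 1) (by omega) (by omega) (by omega) (by omega)
      exact h.comp hf.ennreal_toReal hf.ennreal_toReal
    · intro i
      exact ((hpair (2 * i + r)).trans (hpair (2 * 0 + r)).symm).comp hf.ennreal_toReal
  filter_upwards [key 0, key 1] with ω h0 h1
  obtain ⟨L0, h0⟩ := h0
  obtain ⟨L1, h1⟩ := h1
  refine ⟨L0 + L1, ?_⟩
  filter_upwards [h0, h1] with k hk0 hk1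
  calc ∑ i ∈ Finset.range k, f (ε i ω, ε (i + 1) ω)
      ≤ ∑ i ∈ Finset.range (2 * k), f (ε i ω, ε (i + 1) ω) :=
        Finset.sum_le_sum_of_subset (Finset.range_mono (by omega))
    _ ≤ L0 * k + L1 * k := by
        rw [sum_range_two_mul fun i => f (ε i ω, ε (i + 1) ω)]
        exact add_le_add hk0 hk1
    _ = _ := by push_cast; ring

end Averages

section Domination

/-- The recursion `u_{j+1} = (u_j + t_j - θ_j)₊` started from `0`. -/
noncomputable def drift (t θ : ℕ → ℝ≥0∞) : ℕ → ℝ≥0∞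
  | 0 => 0
  | j + 1 => drift t θ j + t j - θ j

theorem sum_le_drift_add (t θ : ℕ → ℝ≥0∞) (k : ℕ) :
    ∑ i ∈ Finset.range k, t i ≤ drift t θ k + ∑ i ∈ Finset.range k, θ i := by
  induction k with
  | zero => simp
  | succ k ih =>
    rw [Finset.sum_range_succ, Finset.sum_range_succ]
    calc ∑ i ∈ Finset.range k, t i + t k
        ≤ drift t θ k + ∑ i ∈ Finset.range k, θ i + t k := by gcongr
      _ = (drift t θ k + t k) + ∑ i ∈ Finset.range k, θ i := by ring
      _ ≤ (drift t θ k + t k - θ k + θ k) + ∑ i ∈ Finset.range k, θ i := by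
          exact add_le_add le_tsub_add le_rfl
      _ = _ := by rw [drift]; ring

theorem drift_le (t θ : ℕ → ℝ≥0∞) {N : ℝ≥0∞} (ht : ∀ i, t i ≤ N) (k : ℕ) :
    drift t θ k ≤ k * N := by
  induction k with
  | zero => simp [drift]
  | succ k ih =>
    rw [drift]
    refine tsub_le_self.trans ?_
    push_cast
    rw [add_mul, one_mul]
    exact add_le_add ih (ht k)

variable {Ω Y F : Type*} [MeasurableSpace Y] [MeasurableSpace F]

theorem measurable_drift (G : ℕ → MeasurableSpace Ω) (hG : Monotone G) {t θ : ℕ → Ω → ℝ≥0∞}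
    (ht : ∀ i, Measurable[G (i + 1)] (t i)) (hθ : ∀ i, Measurable[G i] (θ i)) (k : ℕ) :
    Measurable[G k] fun ω => drift (fun i => t i ω) (fun i => θ i ω) k := by
  induction k with
  | zero => exact measurable_const
  | succ k ih =>
    exact ((ih.mono (hG k.le_succ) le_rfl).add (ht k)).sub ((hθ k).mono (hG k.le_succ) le_rfl)

variable {mΩ : MeasurableSpace Ω} {P : Measure Ω}
  {G : ℕ → MeasurableSpace Ω} {η : ℕ → Ω → Y} {ξ : ℕ → Ω → F} {π : Measure F}
  [IsProbabilityMeasure π] {c : ℝ≥0∞}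

/-- The law of `ξ i` given the past `G i` is dominated by `c • π`, in integrated form. -/
def Dominated (P : Measure Ω) (G : ℕ → MeasurableSpace Ω) (η : ℕ → Ω → Y) (ξ : ℕ → Ω → F)
    (π : Measure F) (c : ℝ≥0∞) : Prop :=
  ∀ (i : ℕ) (U : Ω → ℝ≥0∞), Measurable[G i] U → ∀ H : Y × F → ℝ≥0∞, Measurable H →
    ∫⁻ ω, U ω * H (η i ω, ξ i ω) ∂P ≤ c * ∫⁻ ω, U ω * ∫⁻ u, H (η i ω, u) ∂π ∂P

/-- The second moment, under `law (η 0) ⊗ π`, of `W` truncated at the level `N`. -/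
noncomputable def truncSq (P : Measure Ω) (η : ℕ → Ω → Y) (π : Measure F) (W : Y × F → ℝ≥0∞)
    (N : ℝ≥0∞) : ℝ≥0∞ :=
  ∫⁻ ω, ∫⁻ u, min (W (η 0 ω, u)) N ^ 2 ∂π ∂P

theorem lintegral_trunc_sq_le (hdom : Dominated P G η ξ π c)
    (hid : ∀ i, ∀ f : Y → ℝ≥0∞, Measurable f → ∫⁻ ω, f (η i ω) ∂P = ∫⁻ ω, f (η 0 ω) ∂P)
    {W : Y × F → ℝ≥0∞} (hW : Measurable W) (N : ℝ≥0∞) (i : ℕ) :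
    ∫⁻ ω, min (W (η i ω, ξ i ω)) N ^ 2 ∂P ≤ c * truncSq P η π W N := by
  have hH : Measurable fun z : Y × F => min (W z) N ^ 2 := (hW.min measurable_const).pow_const 2
  have h := hdom i 1 measurable_const _ hH
  simp only [Pi.one_apply, one_mul] at h
  rw [hid i _ hH.lintegral_prod_right'] at h
  exact h

variable [IsProbabilityMeasure P]

theorem lintegral_drift_sq_le (hG : Monotone G) (hGm : ∀ i, G i ≤ mΩ)
    (hη : ∀ i, Measurable[G i] (η i)) (hξ : ∀ i, Measurable[G (i + 1)] (ξ i))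
    (hdom : Dominated P G η ξ π c) (hc : c ≠ ∞)
    (hid : ∀ i, ∀ f : Y → ℝ≥0∞, Measurable f → ∫⁻ ω, f (η i ω) ∂P = ∫⁻ ω, f (η 0 ω) ∂P)
    {W : Y × F → ℝ≥0∞} (hW : Measurable W) {N : ℝ≥0∞} (hN : N ≠ ∞) (k : ℕ) :
    ∫⁻ ω, drift (fun i => min (W (η i ω, ξ i ω)) N)
        (fun i => c * ∫⁻ u, min (W (η i ω, u)) N ∂π) k ^ 2 ∂P ≤
      k * ((c + c ^ 2) * truncSq P η π W N) := by
  have hWN : Measurable fun z : Y × F => min (W z) N := hW.min measurable_const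
  have hΦ : Measurable fun y : Y => ∫⁻ u, min (W (y, u)) N ∂π := hWN.lintegral_prod_right'
  set t : ℕ → Ω → ℝ≥0∞ := fun i ω => min (W (η i ω, ξ i ω)) N with ht_def
  set θ : ℕ → Ω → ℝ≥0∞ := fun i ω => c * ∫⁻ u, min (W (η i ω, u)) N ∂π with hθ_def
  have ht : ∀ i, Measurable[G (i + 1)] (t i) := fun i =>
    hWN.comp (((hη i).mono (hG i.le_succ) le_rfl).prodMk (hξ i))
  have hθ : ∀ i, Measurable[G i] (θ i) := fun i => (hΦ.comp (hη i)).const_mul c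
  have htm : ∀ i, Measurable (t i) := fun i => (ht i).mono (hGm _) le_rfl
  have hθm : ∀ i, Measurable (θ i) := fun i => (hθ i).mono (hGm _) le_rfl
  have htN : ∀ i ω, t i ω ≤ N := fun i ω => min_le_right _ _
  have hθN : ∀ i ω, θ i ω ≤ c * N := fun i ω => by
    simp only [hθ_def]
    gcongr
    calc ∫⁻ u, min (W (η i ω, u)) N ∂π ≤ ∫⁻ _, N ∂π := lintegral_mono fun _ => min_le_right _ _
      _ = N := by simp
  set U : ℕ → Ω → ℝ≥0∞ := fun k ω => drift (fun i => t i ω) (fun i => θ i ω) k with hU_def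
  have hU : ∀ k, Measurable[G k] (U k) := fun k => measurable_drift G hG ht hθ k
  have hUm : ∀ k, Measurable (U k) := fun k => (hU k).mono (hGm _) le_rfl
  have hUN : ∀ k ω, U k ω ≤ k * N := fun k ω => drift_le _ _ (fun i => htN i ω) k
  change ∫⁻ ω, U k ω ^ 2 ∂P ≤ _
  induction k with
  | zero => simp [hU_def, drift]
  | succ k ih =>
    have hpt : ∀ ω, U (k + 1) ω ^ 2 + 2 * (U k ω * θ k ω) ≤
        U k ω ^ 2 + 2 * (U k ω * t k ω) + t k ω ^ 2 + θ k ω ^ 2 := fun ω =>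
      tsub_sq_add_le (ne_top_of_le_ne_top (by finiteness) (hUN k ω))
        (ne_top_of_le_ne_top hN (htN k ω)) (ne_top_of_le_ne_top (by finiteness) (hθN k ω))
    have hint := lintegral_mono (μ := P) hpt
    have m1 : Measurable fun ω => U k ω ^ 2 := (hUm k).pow_const 2
    have m2 : Measurable fun ω => U k ω * t k ω := (hUm k).mul (htm k)
    have m3 : Measurable fun ω => t k ω ^ 2 := (htm k).pow_const 2
    have m4 : Measurable fun ω => U k ω * θ k ω := (hUm k).mul (hθm k)
    have m12 : Measurable fun ω => U k ω ^ 2 + 2 * (U k ω * t k ω) := m1.add (m2.const_mul 2)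
    have m123 : Measurable fun ω => U k ω ^ 2 + 2 * (U k ω * t k ω) + t k ω ^ 2 := m12.add m3
    rw [lintegral_add_right _ (m4.const_mul 2), lintegral_add_left m123, lintegral_add_left m12,
      lintegral_add_left m1,
      lintegral_const_mul _ m2, lintegral_const_mul _ m4] at hint
    have hcross : ∫⁻ ω, U k ω * t k ω ∂P ≤ ∫⁻ ω, U k ω * θ k ω ∂P := by
      refine (hdom k (U k) (hU k) _ hWN).trans (le_of_eq ?_)
      rw [← lintegral_const_mul]
      · refine lintegral_congr fun ω => ?_
        simp only [hθ_def]
        ring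
      · exact (hUm k).mul (hΦ.comp ((hη k).mono (hGm k) le_rfl))
    have hfin : ∫⁻ ω, U k ω * θ k ω ∂P ≠ ∞ := by
      refine ne_top_of_le_ne_top (b := (k * N) * (c * N)) (by finiteness) ?_
      calc ∫⁻ ω, U k ω * θ k ω ∂P ≤ ∫⁻ _, (k * N) * (c * N) ∂P :=
            lintegral_mono fun ω => mul_le_mul' (hUN k ω) (hθN k ω)
        _ = _ := by simp
    have ht2 : ∫⁻ ω, t k ω ^ 2 ∂P ≤ c * truncSq P η π W N :=
      lintegral_trunc_sq_le hdom hid hW N k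
    have hθ2 : ∫⁻ ω, θ k ω ^ 2 ∂P ≤ c ^ 2 * truncSq P η π W N := by
      have hsq : Measurable fun z : Y × F => min (W z) N ^ 2 := hWN.pow_const 2
      have e1 : ∫⁻ ω, θ k ω ^ 2 ∂P = c ^ 2 * ∫⁻ ω, (∫⁻ u, min (W (η k ω, u)) N ∂π) ^ 2 ∂P := by
        rw [← lintegral_const_mul]
        · refine lintegral_congr fun ω => ?_
          simp only [hθ_def]
          ring
        · exact (hΦ.comp ((hη k).mono (hGm k) le_rfl)).pow_const 2
      rw [e1, truncSq, ← hid k _ hsq.lintegral_prod_right']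
      gcongr with ω
      exact lintegral_sq_le π (hWN.comp measurable_prodMk_left)
    have h2 : ∫⁻ ω, U (k + 1) ω ^ 2 ∂P + 2 * ∫⁻ ω, U k ω * θ k ω ∂P ≤
        (k * ((c + c ^ 2) * truncSq P η π W N) + c * truncSq P η π W N +
          c ^ 2 * truncSq P η π W N) + 2 * ∫⁻ ω, U k ω * θ k ω ∂P := by
      calc _ ≤ _ := hint
        _ ≤ k * ((c + c ^ 2) * truncSq P η π W N) + 2 * ∫⁻ ω, U k ω * θ k ω ∂P +
            c * truncSq P η π W N + c ^ 2 * truncSq P η π W N := by gcongr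
        _ = _ := by ring
    refine (ENNReal.le_of_add_le_add_right (by finiteness) h2).trans (le_of_eq ?_)
    push_cast
    ring

/-- Along a sequence that is conditionally dominated by an integrable law, averages stay bounded as
soon as the conditional averages do. -/
theorem ae_sum_le_of_dominated (hG : Monotone G) (hGm : ∀ i, G i ≤ mΩ)
    (hη : ∀ i, Measurable[G i] (η i)) (hξ : ∀ i, Measurable[G (i + 1)] (ξ i))
    (hdom : Dominated P G η ξ π c) (hc : c ≠ ∞)
    (hid : ∀ i, ∀ f : Y → ℝ≥0∞, Measurable f → ∫⁻ ω, f (η i ω) ∂P = ∫⁻ ω, f (η 0 ω) ∂P)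
    {W : Y × F → ℝ≥0∞} (hW : Measurable W) (hfin : ∫⁻ ω, ∫⁻ u, W (η 0 ω, u) ∂π ∂P ≠ ∞)
    (havg : ∀ᵐ ω ∂P, ∃ L : ℝ≥0, ∀ᶠ k : ℕ in atTop,
      ∑ i ∈ Finset.range k, ∫⁻ u, W (η i ω, u) ∂π ≤ L * k) :
    ∀ᵐ ω ∂P, ∃ L : ℝ≥0, ∀ᶠ k : ℕ in atTop,
      ∑ i ∈ Finset.range k, W (η i ω, ξ i ω) ≤ L * k := by
  have hηm : ∀ i, Measurable (η i) := fun i => (hη i).mono (hGm _) le_rfl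
  have hξm : ∀ i, Measurable (ξ i) := fun i => (hξ i).mono (hGm _) le_rfl
  have hsum : ∑' m : ℕ, truncSq P η π W (2 ^ m) / 2 ^ m ≤ 4 * ∫⁻ ω, ∫⁻ u, W (η 0 ω, u) ∂π ∂P := by
    have hm : ∀ m : ℕ, Measurable fun z : Y × F => min (W z) (2 ^ m) ^ 2 / 2 ^ m := fun m =>
      ((hW.min measurable_const).pow_const 2).div_const _
    have e : ∀ m : ℕ, truncSq P η π W (2 ^ m) / 2 ^ m =
        ∫⁻ ω, ∫⁻ u, min (W (η 0 ω, u)) (2 ^ m) ^ 2 / 2 ^ m ∂π ∂P := fun m => by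
      have hsq : Measurable fun z : Y × F => min (W z) (2 ^ m) ^ 2 :=
        (hW.min measurable_const).pow_const 2
      have hsq' : Measurable fun ω => ∫⁻ u, min (W (η 0 ω, u)) (2 ^ m) ^ 2 ∂π :=
        hsq.lintegral_prod_right'.comp (hηm 0)
      simp only [div_eq_mul_inv, truncSq]
      rw [← lintegral_mul_const _ hsq']
      refine lintegral_congr fun ω => ?_
      exact (lintegral_mul_const _ (hsq.comp measurable_prodMk_left)).symm
    have hm' : ∀ m : ℕ, Measurable fun ω => ∫⁻ u, min (W (η 0 ω, u)) (2 ^ m) ^ 2 / 2 ^ m ∂π :=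
      fun m => (hm m).lintegral_prod_right'.comp (hηm 0)
    have hW' : Measurable fun ω => ∫⁻ u, W (η 0 ω, u) ∂π :=
      hW.lintegral_prod_right'.comp (hηm 0)
    simp only [e]
    rw [← lintegral_tsum fun m => (hm' m).aemeasurable, ← lintegral_const_mul _ hW']
    refine lintegral_mono fun ω => ?_
    have hm'' : ∀ m : ℕ, Measurable fun u => min (W (η 0 ω, u)) (2 ^ m) ^ 2 / 2 ^ m :=
      fun m => (hm m).comp measurable_prodMk_left
    rw [← lintegral_tsum fun m => (hm'' m).aemeasurable,
      ← lintegral_const_mul _ (show Measurable fun u => W (η 0 ω, u) from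
        hW.comp measurable_prodMk_left)]
    exact lintegral_mono fun u => tsum_trunc_sq_le _
  set U : ℕ → Ω → ℝ≥0∞ := fun m ω => drift (fun i => min (W (η i ω, ξ i ω)) (2 ^ m))
        (fun i => c * ∫⁻ u, min (W (η i ω, u)) (2 ^ m) ∂π) (2 ^ m) with hU_def
  set bad : ℕ → Set Ω := fun m => {ω | 2 ^ m ≤ U m ω} ∪
    ⋃ i ∈ Finset.range (2 ^ m), {ω | 2 ^ m ≤ W (η i ω, ξ i ω)} with hbad
  have h2m : ∀ m : ℕ, (2 : ℝ≥0∞) ^ m ≠ ∞ := fun m => by finiteness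
  have h2m0 : ∀ m : ℕ, (2 : ℝ≥0∞) ^ m ≠ 0 := fun m => by positivity
  have hcheb : ∀ (m : ℕ) (f : Ω → ℝ≥0∞) (v : ℝ≥0∞), Measurable f → ∫⁻ ω, f ω ^ 2 ∂P ≤ v →
      P {ω | 2 ^ m ≤ f ω} ≤ v / (2 ^ m) ^ 2 := fun m f v hf hv => by
    rw [ENNReal.le_div_iff_mul_le (Or.inl (by simp [h2m0])) (Or.inl (by finiteness)), mul_comm]
    refine le_trans ?_ ((mul_meas_ge_le_lintegral (μ := P) (hf.pow_const 2) ((2 ^ m) ^ 2)).trans hv)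
    exact mul_le_mul' le_rfl (measure_mono fun ω (hω : 2 ^ m ≤ f ω) =>
      (pow_le_pow_left' hω 2 : (2 ^ m) ^ 2 ≤ f ω ^ 2))
  have hbadP : ∀ m, P (bad m) ≤ (2 * c + c ^ 2) * (truncSq P η π W (2 ^ m) / 2 ^ m) := by
    intro m
    have hA : 2 ^ m / (2 ^ m) ^ 2 = (2 ^ m : ℝ≥0∞)⁻¹ := by
      rw [sq, ENNReal.div_eq_inv_mul, ENNReal.mul_inv (Or.inl (h2m0 m)) (Or.inl (h2m m)), mul_assoc,
        ENNReal.inv_mul_cancel (h2m0 m) (h2m m), mul_one]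
    have h1 : P {ω | 2 ^ m ≤ U m ω} ≤ (c + c ^ 2) * (truncSq P η π W (2 ^ m) / 2 ^ m) := by
      have hUmeas : Measurable (U m) := by
        have hWN : Measurable fun z : Y × F => min (W z) (2 ^ m) := hW.min measurable_const
        refine measurable_drift (fun _ => mΩ) monotone_const (fun i => ?_) (fun i => ?_) _
        · exact hWN.comp ((hηm i).prodMk (hξm i))
        · exact (hWN.lintegral_prod_right'.comp (hηm i)).const_mul c
      refine (hcheb m (U m) _ hUmeas (lintegral_drift_sq_le hG hGm hη hξ hdom hc hid hW (h2m m)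
        (2 ^ m))).trans (le_of_eq ?_)
      push_cast
      rw [mul_comm, mul_div_assoc, hA, div_eq_mul_inv, mul_assoc]
    have h2 : P (⋃ i ∈ Finset.range (2 ^ m), {ω | 2 ^ m ≤ W (η i ω, ξ i ω)}) ≤
        c * (truncSq P η π W (2 ^ m) / 2 ^ m) := by
      calc _ ≤ ∑ i ∈ Finset.range (2 ^ m), P {ω | 2 ^ m ≤ W (η i ω, ξ i ω)} :=
            measure_biUnion_finset_le _ _
        _ ≤ ∑ i ∈ Finset.range (2 ^ m), c * truncSq P η π W (2 ^ m) / (2 ^ m) ^ 2 := by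
            refine Finset.sum_le_sum fun i _ => ?_
            have h := hcheb m (fun ω => min (W (η i ω, ξ i ω)) (2 ^ m)) _
              ((hW.comp ((hηm i).prodMk (hξm i))).min measurable_const)
              (lintegral_trunc_sq_le hdom hid hW (2 ^ m) i)
            simpa using h
        _ = _ := by
            rw [Finset.sum_const, Finset.card_range, nsmul_eq_mul]
            push_cast
            rw [← mul_div_assoc, mul_comm, mul_div_assoc, hA, div_eq_mul_inv, mul_assoc]
    calc P (bad m) ≤ _ := measure_union_le _ _
      _ ≤ _ := add_le_add h1 h2
      _ = _ := by ring
  have hBC : ∀ᵐ ω ∂P, ∀ᶠ m in atTop, ω ∉ bad m := by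
    refine ae_eventually_notMem (ne_top_of_le_ne_top ?_ (ENNReal.tsum_le_tsum hbadP))
    rw [ENNReal.tsum_mul_left]
    exact ENNReal.mul_ne_top (by finiteness) (ne_top_of_le_ne_top (by finiteness) hsum)
  lift c to ℝ≥0 using hc
  filter_upwards [hBC, havg] with ω hω hL
  obtain ⟨L, hL⟩ := hL
  have hdy : ∀ᶠ m : ℕ in atTop, ∑ i ∈ Finset.range (2 ^ m), W (η i ω, ξ i ω) ≤
      ((1 + c * L : ℝ≥0) : ℝ≥0∞) * 2 ^ m := by
    filter_upwards [hω, (tendsto_pow_atTop_atTop_of_one_lt one_lt_two).eventually hL] with m hm hLm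
    simp only [hbad, Set.mem_union, Set.mem_ofPred_eq, Set.mem_iUnion, not_or, not_exists,
      not_le] at hm
    obtain ⟨hm1, hm2⟩ := hm
    calc ∑ i ∈ Finset.range (2 ^ m), W (η i ω, ξ i ω)
        = ∑ i ∈ Finset.range (2 ^ m), min (W (η i ω, ξ i ω)) (2 ^ m) :=
          Finset.sum_congr rfl fun i hi => (min_eq_left (hm2 i hi).le).symm
      _ ≤ U m ω + ∑ i ∈ Finset.range (2 ^ m), c * ∫⁻ u, min (W (η i ω, u)) (2 ^ m) ∂π :=
          sum_le_drift_add _ _ _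
      _ ≤ 2 ^ m + c * (L * (2 ^ m : ℕ)) := by
          rw [← Finset.mul_sum]
          gcongr
          refine le_trans ?_ hLm
          gcongr
          exact min_le_left _ _
      _ = _ := by push_cast; ring
  obtain ⟨M, hM⟩ := eventually_atTop.1 hdy
  refine ⟨2 * (1 + c * L), ?_⟩
  filter_upwards [eventually_ge_atTop (2 ^ M)] with k hk
  have hk0 : k ≠ 0 := (lt_of_lt_of_le (by positivity) hk).ne'
  have hlog : M ≤ Nat.log 2 k := Nat.le_log_of_pow_le one_lt_two hk
  calc ∑ i ∈ Finset.range k, W (η i ω, ξ i ω)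
      ≤ ∑ i ∈ Finset.range (2 ^ (Nat.log 2 k + 1)), W (η i ω, ξ i ω) :=
        Finset.sum_le_sum_of_subset (Finset.range_mono (Nat.lt_pow_succ_log_self one_lt_two k).le)
    _ ≤ ((1 + c * L : ℝ≥0) : ℝ≥0∞) * 2 ^ (Nat.log 2 k + 1) := hM _ (by omega)
    _ = ((2 * (1 + c * L) : ℝ≥0) : ℝ≥0∞) * (2 ^ Nat.log 2 k : ℕ) := by push_cast; ring
    _ ≤ _ := by
        gcongr
        exact Nat.pow_log_le_self 2 hk0

end Domination

section CondLaw

variable {Ω S T F : Type*} [MeasurableSpace S] [MeasurableSpace T] [MeasurableSpace F]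

theorem measure_inter_preimage_eq {m mΩ : MeasurableSpace Ω} {P : Measure Ω} [IsProbabilityMeasure P]
    (hm : m ≤ mΩ) (κ : Kernel S F) [IsMarkovKernel κ] {x : Ω → S} (hx : Measurable[m] x)
    {ξ : Ω → F} (hξ : Measurable ξ)
    (hcond : ∀ A, MeasurableSet A → P⟦ξ ⁻¹' A | m⟧ =ᵐ[P] fun ω => (κ (x ω)).real A)
    {B : Set Ω} (hB : MeasurableSet[m] B) {A : Set F} (hA : MeasurableSet A) :
    P (B ∩ ξ ⁻¹' A) = ∫⁻ ω in B, κ (x ω) A ∂P := by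
  have hxm : Measurable x := hx.mono hm le_rfl
  have hint : Integrable ((ξ ⁻¹' A).indicator fun _ => (1 : ℝ)) P :=
    (integrable_const 1).indicator (hξ hA)
  have h1 := setIntegral_condExp hm hint hB
  rw [setIntegral_congr_ae (hm _ hB) ((hcond A hA).mono fun ω h _ => h),
    setIntegral_indicator (hξ hA), setIntegral_const, smul_eq_mul, mul_one] at h1
  have h2 : ∫ ω in B, (κ (x ω)).real A ∂P = (∫⁻ ω in B, κ (x ω) A ∂P).toReal :=
    integral_toReal ((κ.measurable_coe hA).comp hxm).aemeasurable
      (ae_of_all _ fun ω => measure_lt_top _ _)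
  rw [h2, Measure.real, eq_comm, ENNReal.toReal_eq_toReal_iff' (measure_ne_top _ _)] at h1
  · exact h1
  · refine ne_top_of_le_ne_top (b := ∫⁻ _ in B, 1 ∂P) (by simp) (lintegral_mono fun ω => prob_le_one)

theorem map_prodMk_eq_compProd {m mΩ : MeasurableSpace Ω} {P : Measure Ω} [IsProbabilityMeasure P]
    (hm : m ≤ mΩ) (κ : Kernel S F) [IsMarkovKernel κ] {x : Ω → S} (hx : Measurable[m] x)
    {ξ : Ω → F} (hξ : Measurable ξ)
    (hcond : ∀ A, MeasurableSet A → P⟦ξ ⁻¹' A | m⟧ =ᵐ[P] fun ω => (κ (x ω)).real A)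
    {t : Ω → T} (ht : Measurable[m] t) :
    P.map (fun ω => ((t ω, x ω), ξ ω)) =
      (P.map fun ω => (t ω, x ω)) ⊗ₘ (κ.comap Prod.snd measurable_snd) := by
  have htx : Measurable[m] fun ω => (t ω, x ω) := ht.prodMk hx
  have htxm : Measurable fun ω => (t ω, x ω) := htx.mono hm le_rfl
  have : IsProbabilityMeasure (P.map fun ω => (t ω, x ω)) :=
    Measure.isProbabilityMeasure_map htxm.aemeasurable
  have : IsProbabilityMeasure (P.map fun ω => ((t ω, x ω), ξ ω)) :=
    Measure.isProbabilityMeasure_map (htxm.prodMk hξ).aemeasurable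
  refine Measure.ext_prod fun {B A} hB hA => ?_
  rw [Measure.map_apply (htxm.prodMk hξ) (hB.prod hA), Measure.compProd_apply_prod hB hA,
    setLIntegral_map hB (((κ.comap Prod.snd measurable_snd).measurable_coe hA)) htxm]
  exact measure_inter_preimage_eq hm κ hx hξ hcond (htx hB) hA

/-- If the conditional law of `ξ` given `m` is dominated by `c • π`, then so are the expectations of
non-negative functions of `ξ` and of an `m`-measurable variable. -/
theorem lintegral_le_of_condLaw_le {m mΩ : MeasurableSpace Ω} {P : Measure Ω}
    [IsProbabilityMeasure P]
    (hm : m ≤ mΩ) (κ : Kernel S F) [IsMarkovKernel κ] {x : Ω → S} (hx : Measurable[m] x)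
    {ξ : Ω → F} (hξ : Measurable ξ)
    (hcond : ∀ A, MeasurableSet A → P⟦ξ ⁻¹' A | m⟧ =ᵐ[P] fun ω => (κ (x ω)).real A)
    {c : ℝ≥0∞} {π : Measure F} [SFinite π] (hκ : ∀ s, κ s ≤ c • π) {t : Ω → T}
    (ht : Measurable[m] t) {H : T × F → ℝ≥0∞} (hH : Measurable H) :
    ∫⁻ ω, H (t ω, ξ ω) ∂P ≤ c * ∫⁻ ω, ∫⁻ u, H (t ω, u) ∂π ∂P := by
  have htxm : Measurable fun ω => (t ω, x ω) := (ht.prodMk hx).mono hm le_rfl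
  have htm : Measurable t := ht.mono hm le_rfl
  have hH' : Measurable fun z : (T × S) × F => H (z.1.1, z.2) := hH.comp (by fun_prop)
  calc ∫⁻ ω, H (t ω, ξ ω) ∂P
      = ∫⁻ z, H (z.1.1, z.2) ∂P.map (fun ω => ((t ω, x ω), ξ ω)) :=
        (lintegral_map hH' (htxm.prodMk hξ)).symm
    _ = ∫⁻ ω, ∫⁻ u, H (t ω, u) ∂κ (x ω) ∂P := by
        rw [map_prodMk_eq_compProd hm κ hx hξ hcond ht, Measure.lintegral_compProd hH',
          lintegral_map hH'.lintegral_kernel_prod_right' htxm]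
        rfl
    _ ≤ ∫⁻ ω, c * ∫⁻ u, H (t ω, u) ∂π ∂P := by
        refine lintegral_mono fun ω => ?_
        calc ∫⁻ u, H (t ω, u) ∂κ (x ω) ≤ ∫⁻ u, H (t ω, u) ∂(c • π) :=
              lintegral_mono' (hκ _) le_rfl
          _ = _ := by rw [lintegral_smul_measure, smul_eq_mul]
    _ = _ := lintegral_const_mul _ (hH.lintegral_prod_right'.comp htm)

end CondLaw

section ObservedSystem

theorem IsProbDensity.isProbabilityMeasure {d : ℕ} {φ : E d → ℝ} (hφ : IsProbDensity φ) :
    IsProbabilityMeasure (volume.withDensity fun u => ENNReal.ofReal (φ u)) :=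
  ⟨by rw [withDensity_apply _ MeasurableSet.univ, Measure.restrict_univ, hφ.lintegral_eq_one]⟩

/-- The Markov kernel with densities `q x ·`. -/
noncomputable def densityKernel {d : ℕ} (q : E d → E d → ℝ) : Kernel (E d) (E d) :=
  Kernel.withDensity (Kernel.const (E d) (volume : Measure (E d))) fun x u => ENNReal.ofReal (q x u)

theorem densityKernel_apply {d : ℕ} {q : E d → E d → ℝ} (hq : IsDensityKernel q) (x : E d) :
    densityKernel q x = volume.withDensity fun u => ENNReal.ofReal (q x u) := by
  have hm : Measurable (Function.uncurry fun x u => ENNReal.ofReal (q x u)) :=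
    ENNReal.measurable_ofReal.comp hq.measurable
  rw [densityKernel, Kernel.withDensity_apply _ hm, Kernel.const_apply]

theorem isMarkovKernel_densityKernel {d : ℕ} {q : E d → E d → ℝ} (hq : IsDensityKernel q) :
    IsMarkovKernel (densityKernel q) :=
  ⟨fun x => by
    rw [densityKernel_apply hq]
    exact (hq.isProbDensity x).isProbabilityMeasure⟩

variable {n p : ℕ} {Ω : Type*}

/-- The σ-algebra of the states up to time `k` and the observation noises up to time `k + 1`. -/
abbrev history (X : ℕ → Ω → E n) (ε : ℕ → Ω → E p) (k : ℕ) : MeasurableSpace Ω :=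
  (⨆ j ∈ Set.Iic k, MeasurableSpace.comap (X j) inferInstance) ⊔
    (⨆ j ∈ Set.Iic (k + 1), MeasurableSpace.comap (ε j) inferInstance)

theorem history_mono (X : ℕ → Ω → E n) (ε : ℕ → Ω → E p) : Monotone (history X ε) := by
  intro k l hkl
  refine sup_le_sup ?_ ?_
  · exact biSup_mono fun j hj => le_trans hj hkl
  · exact biSup_mono fun j hj => le_trans hj (Nat.succ_le_succ hkl)

theorem measurable_history_state (X : ℕ → Ω → E n) (ε : ℕ → Ω → E p) {j k : ℕ} (h : j ≤ k) :
    Measurable[history X ε k] (X j) :=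
  measurable_iff_comap_le.2 (le_trans (le_biSup (fun j => MeasurableSpace.comap (X j) inferInstance)
    (Set.mem_Iic.2 h)) le_sup_left)

theorem measurable_history_noise (X : ℕ → Ω → E n) (ε : ℕ → Ω → E p) {j k : ℕ} (h : j ≤ k + 1) :
    Measurable[history X ε k] (ε j) :=
  measurable_iff_comap_le.2 (le_trans (le_biSup (fun j => MeasurableSpace.comap (ε j) inferInstance)
    (Set.mem_Iic.2 h)) le_sup_right)

variable [mΩ : MeasurableSpace Ω]

theorem history_le {X : ℕ → Ω → E n} {ε : ℕ → Ω → E p} (hX : ∀ k, Measurable (X k))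
    (hε : ∀ k, Measurable (ε k)) (k : ℕ) : history X ε k ≤ mΩ :=
  sup_le (iSup₂_le fun j _ => (hX j).comap_le) (iSup₂_le fun j _ => (hε j).comap_le)

variable {P : Measure Ω} [IsProbabilityMeasure P]
  {fs : E n → E n} {hs : E n → E p} {qs : E n → E n → ℝ}
  {as : ℝ≥0} {b₀s bs : ℝ} {ψs : E n → ℝ} {μms μps : ℝ}
  {X ζ : ℕ → Ω → E n} {ε Y : ℕ → Ω → E p}

theorem dominated_noise (hcoef : ObservedCoefficients fs hs qs as b₀s bs ψs μms μps)
    (hsys : IsObservedSystem P fs hs qs X ζ ε Y) :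
    Dominated P (history X ε) (fun i ω => (ε i ω, ε (i + 1) ω)) (fun i => ζ (i + 1))
      (volume.withDensity fun u => ENNReal.ofReal (ψs u)) (ENNReal.ofReal μps) := by
  intro i U hU H hH
  have := isMarkovKernel_densityKernel hcoef.isDensityKernel
  have hη : Measurable[history X ε i] fun ω => (ε i ω, ε (i + 1) ω) :=
    (measurable_history_noise X ε (by omega)).prodMk (measurable_history_noise X ε (by omega))
  have hcond : ∀ A, MeasurableSet A → P⟦ζ (i + 1) ⁻¹' A | history X ε i⟧ =ᵐ[P]
      fun ω => (densityKernel qs (X i ω)).real A := fun A hA => by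
    refine (hsys.cond_law i A hA).trans (ae_of_all _ fun ω => ?_)
    have hd := hcoef.isDensityKernel.isProbDensity (X i ω)
    simp only
    rw [integral_eq_lintegral_of_nonneg_ae (ae_of_all _ hd.nonneg)
      hd.measurable.aestronglyMeasurable, Measure.real, densityKernel_apply hcoef.isDensityKernel,
      withDensity_apply _ hA]
  have hle : ∀ x, densityKernel qs x ≤
      ENNReal.ofReal μps • volume.withDensity fun u => ENNReal.ofReal (ψs u) := fun x => by
    have hm : Measurable fun u => ENNReal.ofReal (ψs u) :=
      ENNReal.measurable_ofReal.comp hcoef.isProbDensity.measurable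
    rw [densityKernel_apply hcoef.isDensityKernel, ← withDensity_smul _ hm]
    refine withDensity_mono (ae_of_all _ fun u => ?_)
    rw [Pi.smul_apply, smul_eq_mul, ← ENNReal.ofReal_mul hcoef.upper_pos.le]
    exact ENNReal.ofReal_le_ofReal (hcoef.upper x u)
  have h := lintegral_le_of_condLaw_le (history_le hsys.measurable_X hsys.measurable_ε i)
    (densityKernel qs) (measurable_history_state X ε le_rfl) (hsys.measurable_ζ (i + 1)) hcond hle
    (hU.prodMk hη) (H := fun z => z.1.1 * H (z.1.2, z.2))
    ((measurable_fst.comp measurable_fst).mul (hH.comp (by fun_prop)))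
  refine h.trans (le_of_eq ?_)
  congr 1
  refine lintegral_congr fun ω => ?_
  exact lintegral_const_mul _ (hH.comp measurable_prodMk_left)

/-- Almost surely, the averages of a function of `(ε_k, ε_{k+1}, ζ_{k+1})` that is integrable when
`ζ_{k+1}` is replaced by an independent variable with density `ψs` are bounded. -/
theorem ae_sum_noise_le (hcoef : ObservedCoefficients fs hs qs as b₀s bs ψs μms μps)
    (hsys : IsObservedSystem P fs hs qs X ζ ε Y) {W : (E p × E p) × E n → ℝ≥0∞}
    (hW : Measurable W)
    (hfin : ∫⁻ ω, ∫⁻ u, W ((ε 0 ω, ε 1 ω), u)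
      ∂(volume.withDensity fun u => ENNReal.ofReal (ψs u)) ∂P ≠ ∞) :
    ∀ᵐ ω ∂P, ∃ L : ℝ≥0, ∀ᶠ k : ℕ in atTop,
      ∑ i ∈ Finset.range k, W ((ε i ω, ε (i + 1) ω), ζ (i + 1) ω) ≤ L * k := by
  have := hcoef.isProbDensity.isProbabilityMeasure
  refine ae_sum_le_of_dominated (history_mono X ε)
    (history_le hsys.measurable_X hsys.measurable_ε) (fun i => ?_) (fun i => ?_)
    (dominated_noise hcoef hsys) ENNReal.ofReal_ne_top (fun i f hf => ?_) hW hfin ?_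
  · exact (measurable_history_noise X ε (by omega)).prodMk
      (measurable_history_noise X ε (by omega))
  · have h : ζ (i + 1) = fun ω => X (i + 1) ω - fs (X i ω) := by
      ext1 ω
      rw [hsys.state_eq]
      abel
    rw [h]
    exact (measurable_history_state X ε le_rfl).sub
      (hcoef.lipschitz.continuous.measurable.comp (measurable_history_state X ε i.le_succ))
  · have hpair : IdentDistrib (fun ω => (ε i ω, ε (i + 1) ω)) (fun ω => (ε 0 ω, ε (0 + 1) ω)) P P := by
      refine IdentDistrib.prodMk (hsys.identDistrib_ε i)
        ((hsys.identDistrib_ε (i + 1)).trans (hsys.identDistrib_ε 1).symm) ?_ ?_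
      · exact hsys.indep_ε.indepFun (by omega)
      · exact hsys.indep_ε.indepFun (by omega)
    exact (hpair.comp hf).lintegral_eq
  · exact ae_sum_consecutive_le hsys.measurable_ε hsys.indep_ε hsys.identDistrib_ε
      hW.lintegral_prod_right' hfin

end ObservedSystem

section Decay

variable {S : Type*} [MeasurableSpace S]

theorem step_univ_le (l : Measure S) [SFinite l] {κ : S → S → ℝ≥0∞}
    (hκ : Measurable (Function.uncurry κ)) (hκ1 : ∀ x, ∫⁻ x', κ x x' ∂l ≤ 1) {g : S → ℝ≥0∞}
    (hg : Measurable g) {B : ℝ≥0∞} (hB : ∀ x, g x ≤ B) (m : Measure S) [SFinite m] :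
    step l (fun x x' => κ x x' * g x') m Set.univ ≤ B * m Set.univ := by
  have hw : Measurable (Function.uncurry fun x x' => κ x x' * g x') :=
    hκ.mul (hg.comp measurable_snd)
  rw [← lintegral_one, lintegral_step l hw m measurable_const]
  calc ∫⁻ x, ∫⁻ x', κ x x' * g x' * 1 ∂l ∂m ≤ ∫⁻ x, B ∂m := by
        refine lintegral_mono fun x => ?_
        calc ∫⁻ x', κ x x' * g x' * 1 ∂l ≤ ∫⁻ x', κ x x' * B ∂l := by
              refine lintegral_mono fun x' => ?_
              rw [mul_one]
              exact mul_le_mul' le_rfl (hB x')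
          _ = (∫⁻ x', κ x x' ∂l) * B := lintegral_mul_const _ hκ.of_uncurry_left
          _ ≤ B := mul_le_of_le_one_left' (hκ1 x)
    _ = _ := by simp

open Classical in
theorem prod_ite_le {B τ : ℝ≥0∞} (hτ : τ ≤ 1) (J : Set ℕ) {k : ℕ}
    (hJ : 3 * (k / 4) ≤ ((Finset.range k).filter (· ∈ J)).card) :
    ∏ i ∈ Finset.range k, (B ^ 2 * if i ∈ J then τ else 2) ≤
      (2 * B ^ 2) ^ k * τ ^ (3 * (k / 4)) := by
  rw [Finset.prod_mul_distrib, Finset.prod_const, Finset.card_range, Finset.prod_ite,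
    Finset.prod_const, Finset.prod_const, mul_pow, mul_comm (2 ^ k), mul_assoc]
  refine mul_le_mul' le_rfl ?_
  rw [mul_comm]
  refine mul_le_mul' ?_ ?_
  · exact pow_le_pow_right₀ (by norm_num)
      ((Finset.card_filter_le _ _).trans (Finset.card_range k).le)
  · exact pow_le_pow_right_of_le_one' hτ hJ

open Classical in
/-- Two weighted chains whose total masses decay at most exponentially, and whose transition density
is bounded from below at sufficiently many times, forget their initial laws exponentially fast,
provided that the weights are small enough outside the sets `C i` and that large values of the
transition density carry little mass. -/
theorem exists_tv_normalized_le (l : Measure S) [SFinite l] {κ : S → S → ℝ≥0∞}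
    (hκ : Measurable (Function.uncurry κ)) (hκ1 : ∀ x, ∫⁻ x', κ x x' ∂l ≤ 1)
    {g : ℕ → S → ℝ≥0∞} (hg : ∀ i, Measurable (g i)) {C : ℕ → Set S}
    (hC : ∀ i, MeasurableSet (C i)) {J : Set ℕ} {ε K B Q : ℝ≥0} {lb z₀ : ℝ≥0∞}
    (hε0 : 0 < ε) (hεK : ε ≤ K)
    (hmin : ∀ i ∈ J, ∀ x ∈ C i, ∀ x' ∈ C (i + 1), (ε : ℝ≥0∞) ≤ κ x x')
    (hB : ∀ i x, g i x ≤ B) (hQ1 : 1 ≤ Q) (hQ : 2 * (B : ℝ≥0∞) ^ 2 ≤ Q * lb ^ 2)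
    (hδ : ∀ x, ∫⁻ x' in {x' | (K : ℝ≥0∞) < κ x x'}, κ x x' ∂l ≤ ((32 * Q ^ 2)⁻¹ : ℝ≥0))
    (hη : ∀ i x, x ∉ C i →
      g i x ≤ ((32 * Q ^ 2 * (1 + 16 * Q ^ 2))⁻¹ : ℝ≥0) * (B : ℝ≥0∞))
    {μ μ' : ℕ → Measure S} [IsFiniteMeasure (μ 0)] [IsFiniteMeasure (μ' 0)]
    (hμ : ∀ k, μ (k + 1) = step l (fun x x' => κ x x' * g (k + 1) x') (μ k))
    (hμ' : ∀ k, μ' (k + 1) = step l (fun x x' => κ x x' * g (k + 1) x') (μ' k))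
    (hz₀ : z₀ ≠ 0) (hlb : lb ≠ 0) (hZ : ∀ᶠ k : ℕ in atTop, z₀ * lb ^ k ≤ μ k Set.univ)
    (hZ' : ∀ᶠ k : ℕ in atTop, z₀ * lb ^ k ≤ μ' k Set.univ)
    (hJ : ∀ᶠ k : ℕ in atTop, 3 * (k / 4) ≤ ((Finset.range k).filter (· ∈ J)).card) :
    ∃ A r : ℝ≥0, 0 < r ∧ r < 1 ∧ ∀ᶠ k : ℕ in atTop,
      tv ((μ k Set.univ)⁻¹ • μ k) ((μ' k Set.univ)⁻¹ • μ' k) ≤ A * (r : ℝ≥0∞) ^ (k / 4) := by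
  have hfin : ∀ {m : ℕ → Measure S} [IsFiniteMeasure (m 0)],
      (∀ k, m (k + 1) = step l (fun x x' => κ x x' * g (k + 1) x') (m k)) →
      ∀ k, IsFiniteMeasure (m k) := fun {m} _ hm k => by
    induction k with
    | zero => infer_instance
    | succ k ih =>
      refine ⟨?_⟩
      rw [hm]
      exact (step_univ_le l hκ hκ1 (hg _) (hB _) _).trans_lt
        (ENNReal.mul_lt_top ENNReal.coe_lt_top (measure_lt_top _ _))
  have hfinμ := hfin hμ
  have hfinμ' := hfin hμ'
  have hQ0 : Q ≠ 0 := (zero_lt_one.trans_le hQ1).ne'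
  have hK0 : K ≠ 0 := (hε0.trans_le hεK).ne'
  set τ : ℝ≥0 := (8 * Q ^ 2)⁻¹ with hτ_def
  set ρ : ℝ≥0 := 1 - (ε / K) ^ 2 with hρ_def
  have hεK1 : (ε / K) ^ 2 ≤ 1 := pow_le_one' (div_le_one_of_le₀ hεK zero_le) 2
  have hρlt : ρ < 1 := tsub_lt_self one_pos (pow_pos (div_pos hε0 (hε0.trans_le hεK)) 2)
  have hρeq : ρ + (ε / K) ^ 2 = 1 := tsub_add_cancel_of_le hεK1
  have hτ1 : τ ≤ 1 := by
    refine inv_le_one_of_one_le₀ ?_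
    have : (1 : ℝ≥0) ≤ Q ^ 2 := one_le_pow₀ hQ1
    calc (1 : ℝ≥0) ≤ 8 * 1 := by norm_num
      _ ≤ _ := by gcongr
  have hρ : ∀ t ≤ (K : ℝ≥0∞) ^ 2, t ≤ (ρ : ℝ≥0∞) * t + (ε : ℝ≥0∞) ^ 2 := by
    intro t ht
    lift t to ℝ≥0 using ne_top_of_le_ne_top (by finiteness) ht
    norm_cast at ht ⊢
    calc t = ρ * t + (ε / K) ^ 2 * t := by rw [← add_mul, hρeq, one_mul]
      _ ≤ ρ * t + (ε / K) ^ 2 * K ^ 2 := by gcongr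
      _ = _ := by rw [div_pow, div_mul_cancel₀ _ (pow_ne_zero 2 hK0)]
  have hθ : (1 : ℝ≥0∞) ≤ ((32 * Q ^ 2 : ℝ≥0) : ℝ≥0∞) * (((32 * Q ^ 2)⁻¹ : ℝ≥0) : ℝ≥0∞) := by
    rw [← ENNReal.coe_mul, mul_inv_cancel₀ (by positivity), ENNReal.coe_one]
  have hηc : (32 * Q ^ 2 * (1 + 16 * Q ^ 2))⁻¹ * (1 + 16 * Q ^ 2) = (32 * Q ^ 2)⁻¹ := by
    rw [mul_inv, mul_assoc, inv_mul_cancel₀ (by positivity), mul_one]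
  have h32 : (32 * Q ^ 2)⁻¹ = τ / 4 := by
    rw [hτ_def]
    field_simp
    norm_num
  have h32le : (32 * Q ^ 2)⁻¹ ≤ 1 := by
    rw [h32]
    exact (div_le_self zero_le (by norm_num)).trans hτ1
  have hsplit := exists_split l hκ hκ1 hg hC J (ε := ε) (K := K) (ρ := ρ)
    (θ := ((32 * Q ^ 2 : ℝ≥0) : ℝ≥0∞)) (ϑ := (((32 * Q ^ 2)⁻¹ : ℝ≥0) : ℝ≥0∞)) (B := B)
    (η := (((32 * Q ^ 2 * (1 + 16 * Q ^ 2))⁻¹ : ℝ≥0) : ℝ≥0∞))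
    (δ := (((32 * Q ^ 2)⁻¹ : ℝ≥0) : ℝ≥0∞)) (τ := (τ : ℝ≥0∞)) (c := ((16 * Q ^ 2 : ℝ≥0) : ℝ≥0∞))
    hmin (by exact_mod_cast hρlt.le) hρ hθ (by exact_mod_cast h32le) hδ hB hη
    (by
      have : (32 * Q ^ 2 * (1 + 16 * Q ^ 2))⁻¹ * (1 + 16 * Q ^ 2) ≤ 1 := by rw [hηc]; exact h32le
      exact_mod_cast this)
    (by
      have : 2 ≤ τ * (1 + 16 * Q ^ 2) := by
        calc (2 : ℝ≥0) = τ * (16 * Q ^ 2) := by rw [hτ_def]; field_simp; norm_num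
          _ ≤ _ := by gcongr; exact le_add_self
      exact_mod_cast this)
    (by
      have : (32 * Q ^ 2)⁻¹ + (32 * Q ^ 2 * (1 + 16 * Q ^ 2))⁻¹ * (1 + 16 * Q ^ 2) +
          (32 * Q ^ 2)⁻¹ + (32 * Q ^ 2)⁻¹ ≤ τ := by
        rw [hηc, h32]
        apply le_of_eq
        ring
      exact_mod_cast this)
    hμ hμ'
  set c₁ : ℝ≥0∞ := (1 + ((16 * Q ^ 2 : ℝ≥0) : ℝ≥0∞)) * (μ 0 Set.univ * μ' 0 Set.univ) with hc₁
  have hc₁top : c₁ ≠ ∞ := by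
    rw [hc₁]
    have := measure_ne_top (μ 0) Set.univ
    have := measure_ne_top (μ' 0) Set.univ
    finiteness
  set A : ℝ≥0∞ := 1 + c₁ * Q ^ 4 * (z₀ ^ 2)⁻¹ with hA_def
  have hAtop : A ≠ ∞ := by
    have : (z₀ ^ 2)⁻¹ ≠ ∞ := ENNReal.inv_ne_top.2 (pow_ne_zero 2 hz₀)
    rw [hA_def]
    finiteness
  refine ⟨A.toNNReal, max ρ 2⁻¹, lt_max_of_lt_right (by norm_num),
    max_lt hρlt (by norm_num [inv_lt_one₀]), ?_⟩
  rw [ENNReal.coe_toNNReal hAtop]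
  filter_upwards [hZ, hZ', hJ] with k hZk hZk' hJk
  have := hfinμ k
  have := hfinμ' k
  obtain ⟨D, R, T, hDf, hRf, hTf, hN, hR, hD, hT⟩ := hsplit k
  set m := k / 4 with hm_def
  have hpos : z₀ * lb ^ k ≠ 0 := mul_ne_zero hz₀ (pow_ne_zero k hlb)
  have hZ0 : μ k Set.univ ≠ 0 := fun h => hpos (le_bot_iff.1 (hZk.trans_eq h))
  have hZ0' : μ' k Set.univ ≠ 0 := fun h => hpos (le_bot_iff.1 (hZk'.trans_eq h))
  refine (tv_normalized_le (μ k) (μ' k) hZ0 hZ0' hN hR).trans ?_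
  have hZZ0 : μ k Set.univ * μ' k Set.univ ≠ 0 := mul_ne_zero hZ0 hZ0'
  have hZZtop : μ k Set.univ * μ' k Set.univ ≠ ∞ := by finiteness
  have hTuniv : T Set.univ ≤ (2 * (B : ℝ≥0∞) ^ 2) ^ k * (τ : ℝ≥0∞) ^ (3 * m) * c₁ := by
    calc T Set.univ = ∫⁻ _, 1 ∂T := (lintegral_one).symm
      _ ≤ ∫⁻ z, potential ((16 * Q ^ 2 : ℝ≥0) : ℝ≥0∞) (C k) z ∂T :=
          lintegral_mono fun z => one_le_potential _ _ _
      _ ≤ _ := hT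
      _ ≤ _ := by
          gcongr
          exact prod_ite_le (by exact_mod_cast hτ1) J hJk
  have hQk : (2 * (B : ℝ≥0∞) ^ 2) ^ k ≤ Q ^ 4 * (Q ^ 4) ^ m * (lb ^ k) ^ 2 := by
    calc (2 * (B : ℝ≥0∞) ^ 2) ^ k ≤ (Q * lb ^ 2) ^ k := by gcongr
      _ = Q ^ k * (lb ^ k) ^ 2 := by rw [mul_pow, ← pow_mul, ← pow_mul, mul_comm 2 k]
      _ ≤ Q ^ (4 + 4 * m) * (lb ^ k) ^ 2 := by
          gcongr
          · exact_mod_cast hQ1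
          · omega
      _ = _ := by rw [pow_add, pow_mul]
  have hhalf : ((32 * Q ^ 2 : ℝ≥0) : ℝ≥0∞) ^ m * ((Q : ℝ≥0∞) ^ 4) ^ m * (τ : ℝ≥0∞) ^ (3 * m) ≤
      ((2⁻¹ : ℝ≥0) : ℝ≥0∞) ^ m := by
    rw [pow_mul, ← mul_pow, ← mul_pow]
    have : 32 * Q ^ 2 * Q ^ 4 * τ ^ 3 ≤ 2⁻¹ := by
      have : 32 * Q ^ 2 * Q ^ 4 * τ ^ 3 = 32 / 512 := by
        rw [hτ_def]
        field_simp
        norm_num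
      rw [this]
      norm_num [div_le_iff₀]
    gcongr
    exact_mod_cast this
  have hDT : D Set.univ ≤ (ρ : ℝ≥0∞) ^ m * (μ k Set.univ * μ' k Set.univ) +
      c₁ * Q ^ 4 * (z₀ ^ 2)⁻¹ * ((2⁻¹ : ℝ≥0) : ℝ≥0∞) ^ m * (μ k Set.univ * μ' k Set.univ) := by
    have h1 := hD m Set.univ
    simp only [Measure.add_apply, Measure.smul_apply, smul_eq_mul] at h1
    rw [← Set.univ_prod_univ, Measure.prod_prod, Set.univ_prod_univ] at h1
    refine h1.trans (add_le_add le_rfl ?_)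
    have hz2 : (z₀ ^ 2)⁻¹ * z₀ ^ 2 = 1 :=
      ENNReal.inv_mul_cancel (pow_ne_zero 2 hz₀) (by
        refine ENNReal.pow_ne_top fun h => ?_
        rw [h, ENNReal.top_mul (pow_ne_zero k hlb)] at hZk
        exact measure_ne_top (μ k) Set.univ (top_le_iff.1 hZk))
    calc ((32 * Q ^ 2 : ℝ≥0) : ℝ≥0∞) ^ m * T Set.univ
        ≤ ((32 * Q ^ 2 : ℝ≥0) : ℝ≥0∞) ^ m *
          (Q ^ 4 * (Q ^ 4) ^ m * (lb ^ k) ^ 2 * (τ : ℝ≥0∞) ^ (3 * m) * c₁) := by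
          gcongr
          exact hTuniv.trans (by gcongr)
      _ = (((32 * Q ^ 2 : ℝ≥0) : ℝ≥0∞) ^ m * ((Q : ℝ≥0∞) ^ 4) ^ m * (τ : ℝ≥0∞) ^ (3 * m)) *
          (c₁ * Q ^ 4 * (lb ^ k) ^ 2) := by ring
      _ ≤ ((2⁻¹ : ℝ≥0) : ℝ≥0∞) ^ m * (c₁ * Q ^ 4 * (lb ^ k) ^ 2) := by gcongr
      _ = c₁ * Q ^ 4 * ((z₀ ^ 2)⁻¹ * z₀ ^ 2) * ((2⁻¹ : ℝ≥0) : ℝ≥0∞) ^ m * (lb ^ k) ^ 2 := by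
          rw [hz2]; ring
      _ = c₁ * Q ^ 4 * (z₀ ^ 2)⁻¹ * ((2⁻¹ : ℝ≥0) : ℝ≥0∞) ^ m * ((z₀ * lb ^ k) * (z₀ * lb ^ k)) := by
          ring
      _ ≤ _ := by gcongr
  rw [ENNReal.div_le_iff hZZ0 hZZtop]
  refine hDT.trans ?_
  have hr1 : (ρ : ℝ≥0∞) ≤ ((max ρ 2⁻¹ : ℝ≥0) : ℝ≥0∞) := by exact_mod_cast le_max_left _ _
  have hr2 : ((2⁻¹ : ℝ≥0) : ℝ≥0∞) ≤ ((max ρ 2⁻¹ : ℝ≥0) : ℝ≥0∞) := by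
    exact_mod_cast le_max_right _ _
  rw [← add_mul]
  gcongr
  rw [hA_def, add_mul, one_mul]
  gcongr

/-- Exponential decay implies a negative upper exponential rate. -/
theorem limsup_log_div_neg {u : ℕ → ℝ≥0∞} {A r : ℝ≥0} (hr0 : 0 < r) (hr1 : r < 1)
    (hu : ∀ᶠ k : ℕ in atTop, u k ≤ A * (r : ℝ≥0∞) ^ (k / 4)) :
    limsup (fun k : ℕ => ENNReal.log (u k) / ((k : ℝ) : EReal)) atTop < 0 := by
  have hr0' : (0 : ℝ) < r := hr0
  have hlog : Real.log r < 0 := Real.log_neg hr0' hr1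
  set s : ℝ := -Real.log r / 8 with hs
  have hs0 : 0 < s := by rw [hs]; linarith
  have hA0 : (0 : ℝ) < A + 1 := by positivity
  have hev : ∀ᶠ k : ℕ in atTop, ENNReal.log (u k) / ((k : ℝ) : EReal) ≤ ((-s : ℝ) : EReal) := by
    have hlarge : ∀ᶠ k : ℕ in atTop, Real.log (A + 1) - Real.log r ≤ s * k :=
      (tendsto_natCast_atTop_atTop.const_mul_atTop hs0).eventually_ge_atTop _
    filter_upwards [hu, hlarge, eventually_gt_atTop 0] with k hk hkl hk0
    have hk0' : (0 : ℝ) < k := by exact_mod_cast hk0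
    have h1 : u k ≤ ENNReal.ofReal (Real.exp (-s * k)) := by
      refine hk.trans ?_
      have hreal : (A : ℝ) * (r : ℝ) ^ (k / 4) ≤ Real.exp (-s * k) := by
        calc (A : ℝ) * (r : ℝ) ^ (k / 4) ≤ (A + 1) * (r : ℝ) ^ (k / 4) := by
              gcongr; linarith
          _ = Real.exp (Real.log (A + 1) + (k / 4 : ℕ) * Real.log r) := by
              rw [Real.exp_add, Real.exp_log hA0, Real.exp_nat_mul, Real.exp_log hr0']
          _ ≤ Real.exp (-s * k) := by
              rw [Real.exp_le_exp]
              have h4 : (k : ℝ) ≤ 4 * (k / 4 : ℕ) + 4 := by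
                have : k ≤ 4 * (k / 4) + 4 := by omega
                exact_mod_cast this
              have h5 : Real.log r = -(8 * s) := by rw [hs]; ring
              rw [h5] at hkl ⊢
              nlinarith
      calc (A : ℝ≥0∞) * (r : ℝ≥0∞) ^ (k / 4) = ENNReal.ofReal ((A : ℝ) * (r : ℝ) ^ (k / 4)) := by
            rw [ENNReal.ofReal_mul A.coe_nonneg, ENNReal.ofReal_pow r.coe_nonneg]
            simp
        _ ≤ _ := ENNReal.ofReal_le_ofReal hreal
    have h2 : ENNReal.log (u k) ≤ ((-s * k : ℝ) : EReal) := by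
      refine (ENNReal.log_monotone h1).trans (le_of_eq ?_)
      rw [ENNReal.log_ofReal_of_pos (Real.exp_pos _), Real.log_exp]
    rw [EReal.div_le_iff_le_mul (by exact_mod_cast hk0') (EReal.coe_ne_top _)]
    refine h2.trans (le_of_eq ?_)
    rw [mul_comm, ← EReal.coe_mul]
  refine (limsup_le_of_le (h := hev)).trans_lt ?_
  exact_mod_cast neg_lt_zero.2 hs0

end Decay

theorem exp_neg_le_of_abs_log_ne_top {t : ℝ≥0∞} (h : (ENNReal.log t).abs ≠ ∞) :
    ENNReal.ofReal (Real.exp (-(ENNReal.log t).abs.toReal)) ≤ t := by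
  induction ht : ENNReal.log t with
  | bot => simp [ht] at h
  | top => simp [ht] at h
  | coe x =>
    rw [EReal.abs_def, ENNReal.toReal_ofReal (abs_nonneg _), ← ENNReal.exp_log t, ht,
      EReal.exp_coe]
    exact ENNReal.ofReal_le_ofReal (Real.exp_le_exp.2 (neg_abs_le x))

theorem le_add_mulLogPlus (t : ℝ≥0∞) : t ≤ ENNReal.ofReal (Real.exp 1) + mulLogPlus t := by
  rcases le_total t (ENNReal.ofReal (Real.exp 1)) with h | h
  · exact le_add_right h
  · refine le_add_left ?_
    have h1 : (1 : EReal) ≤ ENNReal.log t := by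
      have := ENNReal.log_monotone h
      rwa [ENNReal.log_ofReal_of_pos (Real.exp_pos 1), Real.log_exp] at this
    have h2 : (1 : ℝ≥0∞) ≤ (ENNReal.log t).toENNReal := by
      have := EReal.toENNReal_le_toENNReal h1
      rwa [← EReal.coe_one, EReal.toENNReal_of_ne_top (EReal.coe_ne_top _), EReal.toReal_coe,
        ENNReal.ofReal_one] at this
    exact le_mul_of_one_le_right' h2

theorem measurable_ereal_abs : Measurable EReal.abs := by
  have h1 : Measurable fun x : EReal => x.toENNReal := measurable_ereal_toENNReal
  have h2 : Measurable fun x : EReal => (-x).toENNReal := h1.comp measurable_neg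
  have h : EReal.abs = fun x : EReal => x.toENNReal + (-x).toENNReal := by
    ext1 x
    induction x with
    | bot => simp
    | top => simp
    | coe x =>
      rw [EReal.abs_def, ← EReal.coe_neg, EReal.toENNReal_of_ne_top (EReal.coe_ne_top _),
        EReal.toENNReal_of_ne_top (EReal.coe_ne_top _), EReal.toReal_coe, EReal.toReal_coe]
      rcases le_total 0 x with hx | hx
      · rw [abs_of_nonneg hx, ENNReal.ofReal_of_nonpos (p := -x) (by linarith), add_zero]
      · rw [abs_of_nonpos hx, ENNReal.ofReal_of_nonpos (p := x) hx, zero_add]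
  rw [h]
  exact h1.add h2

theorem measurable_qMinus {d : ℕ} (μm : ℝ) (ψ : E d → ℝ) : Measurable (qMinus μm ψ) := by
  refine Antitone.measurable fun r s hrs => ?_
  unfold qMinus
  gcongr with u
  exact iInf_mono' fun hu => ⟨hu.trans hrs, le_rfl⟩

section Noise

variable {n p : ℕ}

theorem measurable_abs_V (a : ℝ≥0) (b₀ b : ℝ) (as : ℝ≥0) (bs κ μm : ℝ) (ψ : E n → ℝ) (Δ : ℝ) :
    Measurable fun z : (E p × E p) × E n => (V a b₀ b as bs κ μm ψ Δ z.1.1 z.1.2 z.2).abs := by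
  unfold V
  refine measurable_ereal_abs.comp (ENNReal.measurable_log.comp ((measurable_qMinus μm ψ).comp ?_))
  fun_prop

end Noise

namespace Model

variable {n p : ℕ} (M : Model n p)

/-- The density of `M.Q x` at `x'`. -/
noncomputable def transition (x x' : E n) : ℝ≥0∞ := ENNReal.ofReal (M.q x (x' - M.f x))

theorem measurable_transition : Measurable (Function.uncurry M.transition) :=
  ENNReal.measurable_ofReal.comp (M.isDensityKernel_q.measurable.comp
    (measurable_fst.prodMk (measurable_snd.sub (M.measurable_f.comp measurable_fst))))

theorem Q_eq_withDensity (x : E n) : M.Q x = volume.withDensity (M.transition x) := by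
  ext A hA
  rw [M.Q_apply, withDensity_apply _ hA]
  rfl

theorem lintegral_transition (x : E n) : ∫⁻ x', M.transition x x' = 1 := by
  have h := lintegral_sub_right_eq_self (μ := (volume : Measure (E n)))
    (fun u => ENNReal.ofReal (M.q x u)) (M.f x)
  exact h.trans (M.isDensityKernel_q.isProbDensity x).lintegral_eq_one

theorem measurable_g (y : E p) : Measurable fun x => M.g x y :=
  ENNReal.measurable_ofReal.comp (M.isProbDensity_v.measurable.comp
    (measurable_const.sub M.measurable_h))

theorem measurableSet_C (y : E p) (Δ : ℝ) : MeasurableSet (M.C y Δ) :=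
  measurableSet_le (M.measurable_h.sub measurable_const).norm measurable_const

theorem unnormalizedFilter_succ (ν : Measure (E n)) (y : ℕ → E p) (k : ℕ)
    [SFinite (M.unnormalizedFilter ν y k)] :
    M.unnormalizedFilter ν y (k + 1) =
      step volume (fun x x' => M.transition x x' * M.g x' (y (k + 1)))
        (M.unnormalizedFilter ν y k) := by
  have hw : Measurable (Function.uncurry fun x x' => M.transition x x' * M.g x' (y (k + 1))) :=
    M.measurable_transition.mul ((M.measurable_g _).comp measurable_snd)
  refine Measure.ext_of_lintegral _ fun F hF => ?_
  rw [lintegral_step _ hw _ hF, unnormalizedFilter,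
    lintegral_withDensity_eq_lintegral_mul _ (M.measurable_g _) hF,
    Measure.lintegral_bind M.Q.measurable.aemeasurable ((M.measurable_g _).mul hF).aemeasurable]
  refine lintegral_congr fun x => ?_
  rw [Q_eq_withDensity, lintegral_withDensity_eq_lintegral_mul _
    M.measurable_transition.of_uncurry_left ((M.measurable_g _).mul hF)]
  simp only [Pi.mul_apply, mul_assoc]

instance (ν : Measure (E n)) [SFinite ν] (y : ℕ → E p) (k : ℕ) :
    SFinite (M.unnormalizedFilter ν y k) := by
  induction k with
  | zero => rw [unnormalizedFilter]; infer_instance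
  | succ k ih => rw [unnormalizedFilter_succ]; infer_instance

theorem unnormalizedFilter_one_pos (ν : Measure (E n)) [SFinite ν] (y : ℕ → E p) (Δ : ℝ)
    (h : 0 < (ν.bind M.Q) (M.C (y 1) Δ)) : 0 < M.unnormalizedFilter ν y 1 (M.C (y 1) Δ) := by
  have hgpos : ∀ (x : E n) (y : E p), M.g x y ≠ 0 := fun x y =>
    (ENNReal.ofReal_pos.2 (M.v_pos _)).ne'
  have hC := M.measurableSet_C (y 1) Δ
  have hbind : (M.unnormalizedFilter ν y 0).bind M.Q (M.C (y 1) Δ) ≠ 0 := by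
    intro h0
    rw [Measure.bind_apply hC M.Q.measurable.aemeasurable,
      lintegral_eq_zero_iff (M.Q.measurable_coe hC)] at h0
    have hac : ν ≪ M.unnormalizedFilter ν y 0 :=
      withDensity_absolutelyContinuous' (M.measurable_g _).aemeasurable
        (ae_of_all _ fun x => hgpos x _)
    refine h.ne' ?_
    rw [Measure.bind_apply hC M.Q.measurable.aemeasurable,
      lintegral_eq_zero_iff (M.Q.measurable_coe hC)]
    exact hac.ae_le h0
  have hac : (M.unnormalizedFilter ν y 0).bind M.Q ≪ M.unnormalizedFilter ν y 1 :=
    withDensity_absolutelyContinuous' (M.measurable_g _).aemeasurable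
      (ae_of_all _ fun x => hgpos x _)
  exact pos_iff_ne_zero.2 fun h0 => hbind (hac h0)

theorem unnormalizedFilter_succ_ge (ν : Measure (E n)) [SFinite ν] (y : ℕ → E p) (k : ℕ)
    {A A' : Set (E n)} (hA : MeasurableSet A) (hA' : MeasurableSet A') {ε γ vol : ℝ≥0∞}
    (hε : ∀ x ∈ A, ∀ x' ∈ A', ε ≤ M.transition x x') (hγ : ∀ x' ∈ A', γ ≤ M.g x' (y (k + 1)))
    (hvol : vol ≤ volume A') :
    ε * (γ * vol) * M.unnormalizedFilter ν y k A ≤ M.unnormalizedFilter ν y (k + 1) A' := by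
  have hw : Measurable (Function.uncurry fun x x' => M.transition x x' * M.g x' (y (k + 1))) :=
    M.measurable_transition.mul ((M.measurable_g _).comp measurable_snd)
  rw [unnormalizedFilter_succ, ← lintegral_indicator_one hA',
    lintegral_step _ hw _ (measurable_one.indicator hA'), ← setLIntegral_const]
  refine le_trans (lintegral_mono_ae ?_) (setLIntegral_le_lintegral A _)
  refine (ae_restrict_iff' hA).2 (ae_of_all _ fun x hx => ?_)
  calc ε * (γ * vol) ≤ ε * γ * volume A' := by rw [← mul_assoc]; gcongr
    _ = ∫⁻ _ in A', ε * γ := (setLIntegral_const _ _).symm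
    _ ≤ ∫⁻ x' in A', M.transition x x' * M.g x' (y (k + 1)) :=
        setLIntegral_mono' hA' fun x' hx' => mul_le_mul' (hε x hx x' hx') (hγ x' hx')
    _ = _ := by
        rw [← lintegral_indicator hA']
        refine lintegral_congr fun x' => ?_
        by_cases hx' : x' ∈ A'
        · simp [hx']
        · simp [hx']

theorem exists_le_volume_C (hcont : UniformContinuous M.h) (hsurj : Function.Surjective M.h)
    {Δ : ℝ} (hΔ : 0 < Δ) : ∃ w : ℝ≥0∞, w ≠ 0 ∧ ∀ y, w ≤ volume (M.C y Δ) := by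
  obtain ⟨r, hr, h⟩ := Metric.uniformContinuous_iff.1 hcont Δ hΔ
  refine ⟨volume (Metric.ball (0 : E n) r), (Metric.measure_ball_pos _ _ hr).ne', fun y => ?_⟩
  obtain ⟨x, rfl⟩ := hsurj y
  rw [← Measure.addHaar_ball_center volume x r]
  refine measure_mono fun x' hx' => ?_
  change ‖M.h x' - M.h x‖ ≤ Δ
  rw [← dist_eq_norm]
  exact (h hx').le

theorem exists_le_g (hE2 : M.E2) (Δ : ℝ) :
    ∃ γ : ℝ≥0∞, γ ≠ 0 ∧ ∀ y, ∀ x ∈ M.C y Δ, γ ≤ M.g x y := by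
  obtain ⟨m, hm, h⟩ := hE2.pos_on_compact _ (isCompact_closedBall (0 : E p) Δ)
  refine ⟨ENNReal.ofReal m, (ENNReal.ofReal_pos.2 hm).ne', fun y x hx => ?_⟩
  refine ENNReal.ofReal_le_ofReal (h _ ?_)
  rw [mem_closedBall_zero_iff, ← norm_neg, neg_sub]
  exact hx

theorem exists_g_le_of_notMem_C (hE2 : M.E2) {η : ℝ≥0∞} (hη : η ≠ 0) :
    ∃ N : ℕ, ∀ y, ∀ x ∉ M.C y (N + 1), M.g x y ≤ η := by
  have hlim : Tendsto (fun u => ENNReal.ofReal (M.v u)) (cocompact (E p)) (𝓝 0) := by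
    simpa using ENNReal.tendsto_ofReal hE2.tendsto_zero
  have hev := hlim.eventually_le_const (pos_iff_ne_zero.2 hη)
  rw [← Metric.cobounded_eq_cocompact, ← comap_norm_atTop, eventually_comap,
    eventually_atTop] at hev
  obtain ⟨R, hR⟩ := hev
  obtain ⟨N, hN⟩ := exists_nat_ge R
  refine ⟨N, fun y x hx => hR _ ?_ _ rfl⟩
  have hx' : (N : ℝ) + 1 < ‖M.h x - y‖ := not_le.1 hx
  rw [← norm_neg, neg_sub] at hx'
  linarith

theorem exists_setLIntegral_transition_le {ψ : E n → ℝ} {μm μp : ℝ} (hG : M.G ψ μm μp)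
    {δ : ℝ≥0∞} (hδ : δ ≠ 0) :
    ∃ K : ℝ≥0, 1 ≤ K ∧
      ∀ x, ∫⁻ x' in {x' | (K : ℝ≥0∞) < M.transition x x'}, M.transition x x' ≤ δ := by
  set φ : E n → ℝ≥0∞ := fun u => ENNReal.ofReal (μp * ψ u) with hφ
  have hφm : Measurable φ :=
    ENNReal.measurable_ofReal.comp (hG.isProbDensity.measurable.const_mul μp)
  have hφint : ∫⁻ u, φ u = ENNReal.ofReal μp := by
    simp only [hφ, ENNReal.ofReal_mul hG.upper_pos.le]
    have hψ : Measurable fun u => ENNReal.ofReal (ψ u) :=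
      ENNReal.measurable_ofReal.comp hG.isProbDensity.measurable
    rw [lintegral_const_mul _ hψ,
      hG.isProbDensity.lintegral_eq_one, mul_one]
  obtain ⟨δ', hδ', hsmall⟩ := exists_pos_setLIntegral_lt_of_measure_lt
    (μ := (volume : Measure (E n))) (f := φ) (by rw [hφint]; exact ENNReal.ofReal_ne_top) hδ
  obtain ⟨K, hK⟩ : ∃ K : ℕ, ENNReal.ofReal μp / δ' < K :=
    ENNReal.exists_nat_gt (ENNReal.div_ne_top ENNReal.ofReal_ne_top hδ'.ne')
  refine ⟨K + 1, le_add_self, fun x => ?_⟩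
  have hK1 : ((K + 1 : ℝ≥0) : ℝ≥0∞) ≠ 0 := by simp
  have hle : ∀ x', M.transition x x' ≤ φ (x' - M.f x) := fun x' =>
    ENNReal.ofReal_le_ofReal (hG.upper _ _)
  set B : Set (E n) := {u | ((K + 1 : ℝ≥0) : ℝ≥0∞) < φ u} with hB
  have hBm : MeasurableSet B := measurableSet_lt measurable_const hφm
  have hBvol : volume B < δ' := by
    have h1 : volume B ≤ ENNReal.ofReal μp / ((K + 1 : ℝ≥0) : ℝ≥0∞) := by
      rw [ENNReal.le_div_iff_mul_le (Or.inl hK1) (Or.inl ENNReal.coe_ne_top), mul_comm, ← hφint]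
      refine le_trans (mul_le_mul' le_rfl (measure_mono fun u (hu : _ < φ u) => ?_))
        (mul_meas_ge_le_lintegral hφm ((K + 1 : ℝ≥0) : ℝ≥0∞))
      exact (hu.le : ((K + 1 : ℝ≥0) : ℝ≥0∞) ≤ φ u)
    refine h1.trans_lt ?_
    rw [ENNReal.div_lt_iff (Or.inl hK1) (Or.inl ENNReal.coe_ne_top), mul_comm]
    rw [ENNReal.div_lt_iff (Or.inl hδ'.ne') (Or.inr ENNReal.ofReal_ne_top)] at hK
    refine hK.trans_le ?_
    gcongr
    push_cast
    exact le_self_add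
  calc ∫⁻ x' in {x' | ((K + 1 : ℝ≥0) : ℝ≥0∞) < M.transition x x'}, M.transition x x'
      ≤ ∫⁻ x' in (fun x' => x' - M.f x) ⁻¹' B, φ (x' - M.f x) := by
        refine le_trans (lintegral_mono_set fun x' (hx' : _ < M.transition x x') => ?_)
          (lintegral_mono hle)
        exact (hx'.trans_le (hle x') : _ < φ (x' - M.f x))
    _ = ∫⁻ u in B, φ u :=
        (measurePreserving_sub_right (volume : Measure (E n)) (M.f x)).setLIntegral_comp_preimage
          hBm hφm
    _ ≤ δ := (hsmall B hBvol).le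

end Model

theorem tv_self {S : Type*} [MeasurableSpace S] (μ : Measure S) : tv μ μ = 0 := by
  simp [tv]

theorem lintegral_lintegral_ne_top_of_mulLogPlus {Ω F : Type*} [MeasurableSpace Ω]
    [MeasurableSpace F] {P : Measure Ω} [IsFiniteMeasure P] {π : Measure F} [IsFiniteMeasure π]
    {f : Ω × F → ℝ≥0∞} (hf : Measurable f) (h : ∫⁻ z, mulLogPlus (f z) ∂P.prod π < ∞) :
    ∫⁻ ω, ∫⁻ u, f (ω, u) ∂π ∂P ≠ ∞ := by
  rw [← lintegral_prod _ hf.aemeasurable]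
  refine ne_top_of_le_ne_top ?_ (lintegral_mono fun z => le_add_mulLogPlus _)
  rw [lintegral_add_left measurable_const, lintegral_const]
  exact ENNReal.add_ne_top.2 ⟨by finiteness, h.ne⟩

/-- Under the moment condition, the averages of `|V|` along the noises of the observed system are
almost surely bounded. -/
theorem ae_sum_abs_V_le {n p : ℕ} {Ω : Type*} [MeasurableSpace Ω] {P : Measure Ω}
    [IsProbabilityMeasure P] {fs : E n → E n} {hs : E n → E p} {qs : E n → E n → ℝ}
    {as : ℝ≥0} {b₀s bs : ℝ} {ψs : E n → ℝ} {μms μps : ℝ}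
    {X ζ : ℕ → Ω → E n} {ε Y : ℕ → Ω → E p}
    (hcoef : ObservedCoefficients fs hs qs as b₀s bs ψs μms μps)
    (hsys : IsObservedSystem P fs hs qs X ζ ε Y) {a : ℝ≥0} {b₀ b κ μm : ℝ} {ψ : E n → ℝ} {Δ : ℝ}
    (hmoment : ∫⁻ z, mulLogPlus (V a b₀ b as bs κ μm ψ Δ (ε 0 z.1) (ε 1 z.1) z.2).abs
      ∂(P.prod (volume.withDensity fun w => ENNReal.ofReal (ψs w))) < ∞) :
    ∀ᵐ ω ∂P, ∃ L : ℝ≥0, ∀ᶠ k : ℕ in atTop,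
      ∑ i ∈ Finset.range k, (V a b₀ b as bs κ μm ψ Δ (ε i ω) (ε (i + 1) ω) (ζ (i + 1) ω)).abs ≤
        L * k := by
  have := hcoef.isProbDensity.isProbabilityMeasure
  obtain ⟨W, hW, hWV⟩ : ∃ W : (E p × E p) × E n → ℝ≥0∞, Measurable W ∧
      ∀ e₀ e₁ w, (V a b₀ b as bs κ μm ψ Δ e₀ e₁ w).abs = W ((e₀, e₁), w) :=
    ⟨_, measurable_abs_V a b₀ b as bs κ μm ψ Δ, fun _ _ _ => rfl⟩
  simp only [hWV] at hmoment ⊢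
  have hnoise : Measurable fun z : Ω × E n => ((ε 0 z.1, ε 1 z.1), z.2) :=
    (((hsys.measurable_ε 0).comp measurable_fst).prodMk
      ((hsys.measurable_ε 1).comp measurable_fst)).prodMk measurable_snd
  exact ae_sum_noise_le hcoef hsys hW
    (lintegral_lintegral_ne_top_of_mulLogPlus (hW.comp hnoise) hmoment)

open Classical in
theorem three_mul_le_card_of_sum_le {w : ℕ → ℝ≥0∞} {L : ℝ≥0} {J : Set ℕ}
    (hJ : ∀ i, i ∉ J → ((4 * L + 1 : ℝ≥0) : ℝ≥0∞) ≤ w i) {k : ℕ}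
    (h : ∑ i ∈ Finset.range k, w i ≤ L * k) :
    3 * (k / 4) ≤ ((Finset.range k).filter (· ∈ J)).card := by
  have hsplit := Finset.card_filter_add_card_filter_not (s := Finset.range k) (· ∈ J)
  rw [Finset.card_range] at hsplit
  set c := ((Finset.range k).filter (¬ · ∈ J)).card with hc
  have h1 : (c : ℝ≥0∞) * ((4 * L + 1 : ℝ≥0) : ℝ≥0∞) ≤ L * k := by
    calc (c : ℝ≥0∞) * ((4 * L + 1 : ℝ≥0) : ℝ≥0∞)
        = ∑ i ∈ (Finset.range k).filter (¬ · ∈ J), ((4 * L + 1 : ℝ≥0) : ℝ≥0∞) := by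
          rw [Finset.sum_const, nsmul_eq_mul]
      _ ≤ ∑ i ∈ (Finset.range k).filter (¬ · ∈ J), w i := by
          exact Finset.sum_le_sum fun i hi => hJ i (Finset.mem_filter.1 hi).2
      _ ≤ ∑ i ∈ Finset.range k, w i :=
          Finset.sum_le_sum_of_subset (Finset.filter_subset _ _)
      _ ≤ _ := h
  have h2 : (c : ℝ) * (4 * L + 1) ≤ L * k := by exact_mod_cast h1
  have h3 : 4 * c ≤ k := by
    by_contra h4
    push Not at h4
    have h5 : (k : ℝ) ≤ 4 * c := by exact_mod_cast h4.le
    have h6 : (0 : ℝ) < c := by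
      have : 0 < c := by omega
      exact_mod_cast this
    have h7 := mul_le_mul_of_nonneg_left h5 L.coe_nonneg
    linarith
  omega

namespace Model

variable {n p : ℕ} (M : Model n p)

theorem transition_ge_qMinus {ψ : E n → ℝ} {μm μp : ℝ} (hG : M.G ψ μm μp) {x x' : E n} {r : ℝ}
    (h : ‖x' - M.f x‖ ≤ r) : qMinus μm ψ r ≤ M.transition x x' := by
  calc qMinus μm ψ r ≤ ENNReal.ofReal μm * ENNReal.ofReal (ψ (x' - M.f x)) :=
        mul_le_mul' le_rfl (iInf₂_le (x' - M.f x) h)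
    _ = ENNReal.ofReal (μm * ψ (x' - M.f x)) := (ENNReal.ofReal_mul hG.lower_pos.le).symm
    _ ≤ _ := ENNReal.ofReal_le_ofReal (hG.lower _ _)

variable {M} {a : ℝ≥0} {b₀ b : ℝ}

theorem E1.b_pos (hE1 : M.E1 a b₀ b) (hn : n ≠ 0) : 0 < b := by
  by_contra hb
  have : NeZero n := ⟨hn⟩
  obtain ⟨x, hx⟩ := NormedSpace.exists_lt_norm ℝ (E n) b₀
  have h := hE1.preimage_dist _ _ x 0 rfl rfl
  rw [sub_zero] at h
  have := mul_nonpos_of_nonpos_of_nonneg (not_lt.1 hb) (norm_nonneg (M.h x - M.h 0))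
  linarith

/-- Transitions between two consecutive sets `C(Y_k, D)` have innovations that are controlled by the
noises of the observed system. -/
theorem E1.exists_norm_sub_le (hE1 : M.E1 a b₀ b) (hb : 0 < b)
    {fs : E n → E n} {hs : E n → E p} {qs : E n → E n → ℝ} {as : ℝ≥0} {b₀s bs : ℝ}
    {ψs : E n → ℝ} {μms μps : ℝ}
    (hcoef : ObservedCoefficients fs hs qs as b₀s bs ψs μms μps)
    (hf : SupDistFinite M.f fs) (hh : SupDistFinite M.h hs) (κ D : ℝ) :
    ∃ Δ : ℝ, 0 < Δ ∧ ∀ (s₀ : E n) (e₀ e₁ : E p) (w : E n),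
      ∀ x ∈ M.C (hs s₀ + e₀) D, ∀ x' ∈ M.C (hs (fs s₀ + w) + e₁) D,
        ‖x' - M.f x‖ ≤ (a + 1) * b₀ + (a + 1) * b * Δ + κ + 2 * as * bs
          + as * bs * ‖e₀‖ + bs * ‖e₁‖ + ‖w‖ := by
  set F := supDist M.f fs with hF
  set H := supDist M.h hs with hH
  have hFle : ∀ x, ‖M.f x - fs x‖ ≤ F := fun x => le_ciSup hf x
  have hHle : ∀ x, ‖M.h x - hs x‖ ≤ H := fun x => le_ciSup hh x
  have hab : 0 < ((a : ℝ) + 1) * b := by positivity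
  set c := ((a : ℝ) + 1) * b * (D + H) + F + (1 + as) * b₀s - κ - 2 * as * bs with hc
  refine ⟨1 + |c| / (((a : ℝ) + 1) * b), by positivity, fun s₀ e₀ e₁ w x hx x' hx' => ?_⟩
  have hcle : c ≤ ((a : ℝ) + 1) * b * (1 + |c| / (((a : ℝ) + 1) * b)) := by
    rw [mul_add, mul_div_cancel₀ _ hab.ne']
    have := le_abs_self c
    linarith
  obtain ⟨z₀, hz₀⟩ := hcoef.surjective (hs s₀ + e₀)
  obtain ⟨z₁, hz₁⟩ := hcoef.surjective (hs (fs s₀ + w) + e₁)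
  have key : ∀ (D : ℝ) (y : E p) (z x : E n), hs z = y → x ∈ M.C y D →
      ‖x - z‖ ≤ b₀ + b * (D + H) := by
    intro D y z x hz hx
    have h1 := hE1.preimage_dist _ _ x z rfl rfl
    have h2 : ‖M.h x - M.h z‖ ≤ D + H := by
      calc ‖M.h x - M.h z‖ = ‖(M.h x - y) - (M.h z - hs z)‖ := by rw [hz]; congr 1; abel
        _ ≤ ‖M.h x - y‖ + ‖M.h z - hs z‖ := norm_sub_le _ _
        _ ≤ D + H := add_le_add hx (hHle z)
    have := mul_le_mul_of_nonneg_left h2 hb.le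
    linarith
  have k0 := key D _ z₀ x hz₀ hx
  have k1 := key D _ z₁ x' hz₁ hx'
  have d0 : ‖s₀ - z₀‖ ≤ b₀s + bs * ‖e₀‖ := by
    have := hcoef.dist_le s₀ z₀
    rwa [hz₀, sub_add_cancel_left, norm_neg] at this
  have d1 : ‖z₁ - (fs s₀ + w)‖ ≤ b₀s + bs * ‖e₁‖ := by
    have := hcoef.dist_le z₁ (fs s₀ + w)
    rwa [hz₁, add_sub_cancel_left] at this
  have l0 : ‖fs s₀ - fs z₀‖ ≤ as * (b₀s + bs * ‖e₀‖) := by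
    have := hcoef.lipschitz.norm_sub_le s₀ z₀
    exact this.trans (mul_le_mul_of_nonneg_left d0 as.coe_nonneg)
  have l1 : ‖M.f z₀ - M.f x‖ ≤ a * (b₀ + b * (D + H)) := by
    have := hE1.lipschitz.norm_sub_le z₀ x
    rw [norm_sub_rev z₀ x] at this
    exact this.trans (mul_le_mul_of_nonneg_left k0 a.coe_nonneg)
  have l2 : ‖fs z₀ - M.f z₀‖ ≤ F := by rw [norm_sub_rev]; exact hFle z₀
  have hdec : x' - M.f x = (x' - z₁) + (z₁ - (fs s₀ + w)) + w + (fs s₀ - fs z₀) +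
      (fs z₀ - M.f z₀) + (M.f z₀ - M.f x) := by abel
  have htri : ‖x' - M.f x‖ ≤ ‖x' - z₁‖ + ‖z₁ - (fs s₀ + w)‖ + ‖w‖ + ‖fs s₀ - fs z₀‖ +
      ‖fs z₀ - M.f z₀‖ + ‖M.f z₀ - M.f x‖ := by
    rw [hdec]
    refine (norm_add_le _ _).trans (add_le_add ?_ le_rfl)
    refine (norm_add_le _ _).trans (add_le_add ?_ le_rfl)
    refine (norm_add_le _ _).trans (add_le_add ?_ le_rfl)
    refine (norm_add_le _ _).trans (add_le_add ?_ le_rfl)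
    exact norm_add_le _ _
  have hsum : ‖x' - M.f x‖ ≤ ((a : ℝ) + 1) * b₀ + (c + κ + 2 * as * bs) + as * bs * ‖e₀‖ +
      bs * ‖e₁‖ + ‖w‖ := by
    rw [hc]
    linarith
  linarith

/-- The total mass of the unnormalized filter decays at most exponentially, at a rate that does not
depend on the initial law. -/
theorem exists_unnormalizedFilter_ge (hE1 : M.E1 a b₀ b) (hE2 : M.E2) {y : ℕ → E p} {Δ : ℝ}
    (hΔ : 0 < Δ) {w : ℕ → ℝ≥0∞}
    (hw : ∀ i, w i ≠ ∞ → ∀ x ∈ M.C (y i) Δ, ∀ x' ∈ M.C (y (i + 1)) Δ,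
      ENNReal.ofReal (Real.exp (-(w i).toReal)) ≤ M.transition x x')
    {L : ℝ≥0} (hL : ∀ᶠ k : ℕ in atTop, ∑ i ∈ Finset.range k, w i ≤ L * k) :
    ∃ lb : ℝ≥0∞, lb ≠ 0 ∧ lb ≠ ∞ ∧ ∀ ν : Measure (E n), SFinite ν →
      0 < (ν.bind M.Q) (M.C (y 1) Δ) → ∃ z : ℝ≥0∞, z ≠ 0 ∧
        ∀ᶠ k : ℕ in atTop, z * lb ^ k ≤ M.unnormalizedFilter ν y k Set.univ := by
  obtain ⟨vol, hvol0, hvol⟩ := M.exists_le_volume_C hE1.uniformContinuous hE1.surjective hΔ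
  obtain ⟨γ, hγ0, hγ⟩ := M.exists_le_g hE2 Δ
  set u : ℝ≥0∞ := min 1 (γ * vol) with hu_def
  have hu1 : u ≤ 1 := min_le_left _ _
  have hu0 : u ≠ 0 := by
    rw [hu_def, ← pos_iff_ne_zero, lt_min_iff]
    exact ⟨one_pos, pos_iff_ne_zero.2 (mul_ne_zero hγ0 hvol0)⟩
  have hwtop : ∀ i, w i ≠ ∞ := fun i => by
    obtain ⟨k, hk, hik⟩ := (hL.and (eventually_gt_atTop i)).exists
    refine ne_top_of_le_ne_top (b := (L : ℝ≥0∞) * k) (by finiteness) (le_trans ?_ hk)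
    exact Finset.single_le_sum_of_canonicallyOrdered (f := w) (Finset.mem_range.2 hik)
  refine ⟨u * ENNReal.ofReal (Real.exp (-L)), mul_ne_zero hu0
    (ENNReal.ofReal_pos.2 (Real.exp_pos _)).ne', ENNReal.mul_ne_top
    (ne_top_of_le_ne_top ENNReal.one_ne_top hu1) ENNReal.ofReal_ne_top, fun ν _ hν => ?_⟩
  set z := M.unnormalizedFilter ν y 1 (M.C (y 1) Δ) with hz
  refine ⟨z, (M.unnormalizedFilter_one_pos ν y Δ hν).ne', ?_⟩
  have hind : ∀ k : ℕ, z * (u ^ (k + 1) *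
      ENNReal.ofReal (Real.exp (-∑ i ∈ Finset.range (k + 1), (w i).toReal))) ≤
      M.unnormalizedFilter ν y (k + 1) (M.C (y (k + 1)) Δ) := by
    intro k
    induction k with
    | zero =>
      refine mul_le_of_le_one_right' (mul_le_one' (pow_le_one' hu1 _) ?_)
      refine ENNReal.ofReal_le_one.2 (Real.exp_le_one_iff.2 (neg_nonpos.2 ?_))
      exact Finset.sum_nonneg fun i _ => ENNReal.toReal_nonneg
    | succ k ih =>
      have h := M.unnormalizedFilter_succ_ge ν y (k + 1) (M.measurableSet_C _ Δ)
        (M.measurableSet_C _ Δ) (hw (k + 1) (hwtop _)) (hγ (y (k + 1 + 1)))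
        (hvol (y (k + 1 + 1)))
      refine le_trans ?_ h
      rw [Finset.sum_range_succ _ (k + 1), neg_add, Real.exp_add,
        ENNReal.ofReal_mul (Real.exp_pos _).le, pow_succ u (k + 1)]
      calc _ = ENNReal.ofReal (Real.exp (-(w (k + 1)).toReal)) * u * (z * (u ^ (k + 1) *
            ENNReal.ofReal (Real.exp (-∑ i ∈ Finset.range (k + 1), (w i).toReal)))) := by ring
        _ ≤ _ := by
          gcongr
          exact min_le_right _ _
  filter_upwards [hL, eventually_gt_atTop 0] with k hk hk0
  obtain ⟨k, rfl⟩ := Nat.exists_eq_succ_of_ne_zero hk0.ne'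
  refine le_trans ?_ ((hind k).trans (measure_mono (Set.subset_univ _)))
  rw [mul_pow, ← ENNReal.ofReal_pow (Real.exp_pos _).le, ← Real.exp_nat_mul]
  gcongr
  rw [← ENNReal.toReal_sum fun i _ => hwtop i, mul_neg, neg_le_neg_iff]
  have := ENNReal.toReal_mono (by finiteness) hk
  rwa [ENNReal.toReal_mul, ENNReal.coe_toReal, ENNReal.toReal_natCast, mul_comm] at this

theorem limsup_tv_filter_neg (hE1 : M.E1 a b₀ b) (hE2 : M.E2) {ψ : E n → ℝ} {μm μp : ℝ}
    (hG : M.G ψ μm μp) {y : ℕ → E p} {w : ℝ → ℕ → ℝ≥0∞}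
    (hw : ∀ D i, w D i ≠ ∞ → ∀ x ∈ M.C (y i) D, ∀ x' ∈ M.C (y (i + 1)) D,
      ENNReal.ofReal (Real.exp (-(w D i).toReal)) ≤ M.transition x x')
    {Δ : ℝ} (hΔ : 0 < Δ)
    (hwΔ : ∃ L : ℝ≥0, ∀ᶠ k : ℕ in atTop, ∑ i ∈ Finset.range k, w Δ i ≤ L * k)
    (hwN : ∀ N : ℕ, ∃ L : ℝ≥0, ∀ᶠ k : ℕ in atTop,
      ∑ i ∈ Finset.range k, w (N + 1) i ≤ L * k)
    (ν ν' : Measure (E n)) [IsProbabilityMeasure ν] [IsProbabilityMeasure ν']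
    (hν : 0 < (ν.bind M.Q) (M.C (y 1) Δ)) (hν' : 0 < (ν'.bind M.Q) (M.C (y 1) Δ)) :
    limsup (fun k : ℕ => ENNReal.log (tv (M.filter ν y k) (M.filter ν' y k)) / ((k : ℝ) : EReal))
      atTop < 0 := by
  classical
  obtain ⟨LΔ, hLΔ⟩ := hwΔ
  obtain ⟨lb, hlb0, hlbtop, hlb⟩ := exists_unnormalizedFilter_ge hE1 hE2 hΔ (hw Δ) hLΔ
  obtain ⟨z, hz0, hz⟩ := hlb ν inferInstance hν
  obtain ⟨z', hz0', hz'⟩ := hlb ν' inferInstance hν'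
  obtain ⟨B₀, hB₀⟩ := hE2.bounded
  have hB₀pos : 0 < B₀ := (M.v_pos 0).trans_le (hB₀ 0)
  set B : ℝ≥0 := B₀.toNNReal with hB_def
  have hB0 : (B : ℝ≥0∞) ≠ 0 := by
    rw [Ne, ENNReal.coe_eq_zero, hB_def]
    exact (Real.toNNReal_pos.2 hB₀pos).ne'
  have hB : ∀ i x, M.g x (y i) ≤ B := fun i x => ENNReal.ofReal_le_ofReal (hB₀ _)
  set Q : ℝ≥0 := max 1 (2 * (B : ℝ≥0∞) ^ 2 / lb ^ 2).toNNReal with hQ_def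
  have hQ1 : 1 ≤ Q := le_max_left _ _
  have hQ : 2 * (B : ℝ≥0∞) ^ 2 ≤ Q * lb ^ 2 := by
    rw [← ENNReal.div_le_iff (pow_ne_zero 2 hlb0) (by finiteness),
      ← ENNReal.coe_toNNReal (a := 2 * (B : ℝ≥0∞) ^ 2 / lb ^ 2)
        (ENNReal.div_ne_top (by finiteness) (pow_ne_zero 2 hlb0))]
    exact ENNReal.coe_le_coe.2 (le_max_right _ _)
  have hQ0 : 0 < Q := one_pos.trans_le hQ1
  obtain ⟨K, hK1, hK⟩ := M.exists_setLIntegral_transition_le hG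
    (δ := ((32 * Q ^ 2)⁻¹ : ℝ≥0)) (by
      have : (32 * Q ^ 2)⁻¹ ≠ 0 := by positivity
      exact_mod_cast this)
  obtain ⟨N, hN⟩ := M.exists_g_le_of_notMem_C hE2
    (η := ((32 * Q ^ 2 * (1 + 16 * Q ^ 2))⁻¹ : ℝ≥0) * (B : ℝ≥0∞)) (by
      refine mul_ne_zero ?_ hB0
      have : (32 * Q ^ 2 * (1 + 16 * Q ^ 2))⁻¹ ≠ 0 := by positivity
      exact_mod_cast this)
  obtain ⟨L, hL⟩ := hwN N
  set ε : ℝ≥0 := (Real.exp (-(4 * L + 1 : ℝ≥0))).toNNReal with hε_def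
  have hε0 : 0 < ε := Real.toNNReal_pos.2 (Real.exp_pos _)
  have hεK : ε ≤ K := by
    refine le_trans ?_ hK1
    rw [hε_def, Real.toNNReal_le_one, Real.exp_le_one_iff, neg_nonpos]
    exact NNReal.coe_nonneg _
  have : IsFiniteMeasure (M.unnormalizedFilter ν y 0) :=
    ⟨by
      rw [unnormalizedFilter, withDensity_apply _ MeasurableSet.univ, Measure.restrict_univ]
      calc ∫⁻ x, M.g x (y 0) ∂ν ≤ ∫⁻ _, B ∂ν := lintegral_mono (hB 0)
        _ = B := by simp
        _ < ∞ := ENNReal.coe_lt_top⟩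
  have : IsFiniteMeasure (M.unnormalizedFilter ν' y 0) :=
    ⟨by
      rw [unnormalizedFilter, withDensity_apply _ MeasurableSet.univ, Measure.restrict_univ]
      calc ∫⁻ x, M.g x (y 0) ∂ν' ≤ ∫⁻ _, B ∂ν' := lintegral_mono (hB 0)
        _ = B := by simp
        _ < ∞ := ENNReal.coe_lt_top⟩
  obtain ⟨A, r, hr0, hr1, hdecay⟩ := exists_tv_normalized_le (volume : Measure (E n))
    M.measurable_transition (fun x => (M.lintegral_transition x).le)
    (g := fun i x => M.g x (y i)) (fun i => M.measurable_g (y i))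
    (C := fun i => M.C (y i) (N + 1)) (fun i => M.measurableSet_C (y i) _)
    (J := {i | w (N + 1) i ≤ ((4 * L + 1 : ℝ≥0) : ℝ≥0∞)}) (lb := lb) (z₀ := min z z')
    hε0 hεK (by
      intro i hi x hx x' hx'
      have hi' : w (N + 1) i ≤ ((4 * L + 1 : ℝ≥0) : ℝ≥0∞) := hi
      refine le_trans ?_ (hw (N + 1) i (ne_top_of_le_ne_top ENNReal.coe_ne_top hi') x hx x' hx')
      refine ENNReal.ofReal_le_ofReal (Real.exp_le_exp.2 (neg_le_neg ?_))
      exact ENNReal.toReal_mono ENNReal.coe_ne_top hi')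
    hB hQ1 hQ hK (fun i x hx => hN (y i) x hx)
    (M.unnormalizedFilter_succ ν y ·) (M.unnormalizedFilter_succ ν' y ·)
    (by
      rw [← pos_iff_ne_zero, lt_min_iff]
      exact ⟨pos_iff_ne_zero.2 hz0, pos_iff_ne_zero.2 hz0'⟩)
    hlb0
    (hz.mono fun k hk => le_trans (by gcongr; exact min_le_left _ _) hk)
    (hz'.mono fun k hk => le_trans (by gcongr; exact min_le_right _ _) hk)
    (hL.mono fun k hk => three_mul_le_card_of_sum_le (fun i hi => (not_le.1 hi).le) hk)
  exact limsup_log_div_neg hr0 hr1 hdecay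

end Model

end NonlinearFilter

theorem proposition11 {n p : ℕ} (hpn : p ≤ n)
    -- the filtering model and its assumptions
    (M : NonlinearFilter.Model n p)
    (a : ℝ≥0) (b₀ b : ℝ) (hE1 : M.E1 a b₀ b) (hE2 : M.E2)
    (ψ : NonlinearFilter.E n → ℝ) (μm μp : ℝ) (hG : M.G ψ μm μp)
    -- the system that produces the observations
    (fs : NonlinearFilter.E n → NonlinearFilter.E n)
    (hs : NonlinearFilter.E n → NonlinearFilter.E p)
    (qs : NonlinearFilter.E n → NonlinearFilter.E n → ℝ)
    (as : ℝ≥0) (b₀s bs : ℝ) (ψs : NonlinearFilter.E n → ℝ) (μms μps : ℝ)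
    (hcoef : NonlinearFilter.ObservedCoefficients fs hs qs as b₀s bs ψs μms μps)
    {Ω : Type*} [MeasurableSpace Ω] (P : Measure Ω) [IsProbabilityMeasure P]
    (X ζ : ℕ → Ω → NonlinearFilter.E n) (ε Y : ℕ → Ω → NonlinearFilter.E p)
    (hsys : NonlinearFilter.IsObservedSystem P fs hs qs X ζ ε Y)
    -- the two systems are at finite distance
    (hf : NonlinearFilter.SupDistFinite M.f fs) (hh : NonlinearFilter.SupDistFinite M.h hs)
    -- the moment condition; the second coordinate `z.2` is a variable with density `ψs`
    -- independent of the observation noise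
    (hmoment : ∀ Δ : ℝ, 0 < Δ →
      ∫⁻ z, NonlinearFilter.mulLogPlus
          (NonlinearFilter.V a b₀ b as bs (NonlinearFilter.kappa M b₀ b fs hs as) μm ψ Δ
            (ε 0 z.1) (ε 1 z.1) z.2).abs
        ∂(P.prod (volume.withDensity fun w => ENNReal.ofReal (ψs w))) < ∞)
    -- the initial distributions
    (ν ν' : Measure (NonlinearFilter.E n)) [IsProbabilityMeasure ν] [IsProbabilityMeasure ν']
    (Δ : ℝ) (hΔ : 0 < Δ)
    (hν : ∀ᵐ ω ∂P, 0 < (ν.bind M.Q) (M.C (Y 1 ω) Δ))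
    (hν' : ∀ᵐ ω ∂P, 0 < (ν'.bind M.Q) (M.C (Y 1 ω) Δ)) :
    ∀ᵐ ω ∂P,
      limsup (fun k : ℕ =>
        ENNReal.log (NonlinearFilter.tv (M.filter ν (fun i => Y i ω) k)
          (M.filter ν' (fun i => Y i ω) k)) / ((k : ℝ) : EReal)) atTop < 0 := by
  open NonlinearFilter in
  rcases eq_or_ne n 0 with rfl | hn
  · have hνν' : ν = ν' := by
      ext A _
      rcases A.eq_empty_or_nonempty with rfl | hA
      · simp
      · simp [Subsingleton.eq_univ_of_nonempty hA]
    subst hνν'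
    refine ae_of_all _ fun ω => limsup_log_div_neg (A := 0) (r := 2⁻¹) (by norm_num)
      (by norm_num [inv_lt_one₀]) (Eventually.of_forall fun k => ?_)
    rw [tv_self]
    exact zero_le
  · have hb := hE1.b_pos hn
    choose δ hδ0 hδ using hE1.exists_norm_sub_le hb hcoef hf hh (kappa M b₀ b fs hs as)
    have havg : ∀ D : ℝ, ∀ᵐ ω ∂P, ∃ L : ℝ≥0, ∀ᶠ k : ℕ in atTop,
        ∑ i ∈ Finset.range k, (V a b₀ b as bs (kappa M b₀ b fs hs as) μm ψ (δ D) (ε i ω)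
          (ε (i + 1) ω) (ζ (i + 1) ω)).abs ≤ L * k :=
      fun D => ae_sum_abs_V_le hcoef hsys (hmoment (δ D) (hδ0 D))
    filter_upwards [hν, hν', havg Δ, ae_all_iff.2 fun N : ℕ => havg (N + 1)]
      with ω hνω hνω' hωΔ hωN
    refine Model.limsup_tv_filter_neg hE1 hE2 hG
      (w := fun D i => (V a b₀ b as bs (kappa M b₀ b fs hs as) μm ψ (δ D) (ε i ω) (ε (i + 1) ω)
        (ζ (i + 1) ω)).abs) ?_ hΔ hωΔ hωN ν ν' hνω hνω'
    intro D i hfin x hx x' hx'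
    refine (exp_neg_le_of_abs_log_ne_top hfin).trans (M.transition_ge_qMinus hG ?_)
    refine hδ D (X i ω) (ε i ω) (ε (i + 1) ω) (ζ (i + 1) ω) x ?_ x' ?_
    · rwa [← hsys.obs_eq]
    · rwa [← hsys.state_eq, ← hsys.obs_eq]
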